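/- Let $M$ be a smooth paracompact manifold of dimension $n\ge 3$, let $T^\circ M$ be its tangent bundle with the zero section removed, with projection $\tau$ and Liouville field $\Delta$, and let $\Gamma$ be a spray on $T^\circ M$: a smooth vector field with $\tau_*\Gamma_{(x,y)}=y$ and $[\Delta,\Gamma]=\Gamma$. In natural coordinates write $\Gamma=y^i\partial_{x^i}-2\Gamma^i\partial_{y^i}$, $\Gamma^i_j=\partial\Gamma^i/\partial y^j$, $\phi^i=dy^i+\Gamma^i_j\,dx^j$. Let $\mathcal D$ be the distribution spanned by $\Gamma$ and $\Delta$, and assume that its leaves are the fibres of a smooth surjective submersion $\pi:T^\circ M\to P_{\mathcal D}$ onto a $(2n-2)$-dimensional manifold (the path space). Let $h=h_{ij}(x,y)\,dx^i\otimes dx^j$ be a smooth symmetric tensor field along $\tau$, and let $\Omega$ be a symplectic form on $P_{\mathcal D}$ with $\pi^*\Omega=\omega:=h_{ij}\,dx^i\wedge\phi^j$ (so $\omega$ is closed with characteristic distribution $\mathcal D$). Call $h$ everywhere positive quasi-definite if $h_{(x,y)}(v,v)\ge 0$ for all $(x,y)\in T^\circ M$ and $v\in T_xM$, with equality only if $v$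 is a scalar multiple of $y$. A two-dimensional totally-geodesic submanifold is a properly embedded (i.e. closed embedded) surface $N\subset M$ such that $\Gamma$ is tangent to $\hat N=\{(x,y)\in T^\circ M: x\in N,\ y\in T_xN\}$; it induces the surface $\bar N=\pi(\hat N)\subset P_{\mathcal D}$. Suppose that for every $x\in M$ and every two-dimensional subspace $W\subset T_xM$ there is a two-dimensional totally-geodesic submanifold $N$ through $x$ with $T_xN=W$. (1) If $h$ is everywhere positive quasi-definite, then for every two-dimensional totally-geodesic submanifold $N$ the pull-back of $\Omega$ to $\bar N$ is a volume form (that is, at each $p\in\bar N$ the tangent space $T_p\bar N$ is two-dimensional and $\Omega_p$ does not vanish on it). (2) Conversely, if $M$ is connected and the pull-back of $\Omega$ to $\bar N$ is a volume form for every two-dimensional totally-geodesic submanifold $N$, then either $h$ or $-h$ is everywhere positive quasi-definite. -/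

import Mathlib

open Set Filter Topology Module
open scoped Manifold ContDiff

noncomputable section

/-! The base manifold `M` is modelled on `ℝⁿ`.  The tangent bundle of `M` carries Mathlib's smooth
structure; its charts are the tangent maps of the charts of `M`, and the chart at `p = (x, y)` is
the one induced by the chart of `M` at `x`.  Accordingly a vector tangent to the tangent bundle at
`p = (x, y)` is a pair `(ẋ, ẏ)` of vectors of `ℝⁿ`, its components with respect to the natural
coordinates `(xⁱ, yⁱ)` induced by the chart of `M` at `x`. -/

/-- The slit tangent bundle, as an open subset of the tangent bundle. -/
def slit (n : ℕ) (M : Type*) [TopologicalSpace M] [ChartedSpace (EuclideanSpace ℝ (Fin n)) M]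
    [IsManifold (𝓡 n) ∞ M] : Set (TangentBundle (𝓡 n) M) :=
  {p | p.2 ≠ 0}

/-- The natural coordinate components `(ẋ, ẏ)` of a vector tangent to the tangent bundle at
`(x, y)`, in the coordinates induced by the chart at `x`. -/
def comps {n : ℕ} {M : Type*} [TopologicalSpace M] [ChartedSpace (EuclideanSpace ℝ (Fin n)) M]
    [IsManifold (𝓡 n) ∞ M] {p : TangentBundle (𝓡 n) M} (X : TangentSpace (𝓡 n).tangent p) :
    EuclideanSpace ℝ (Fin n) × EuclideanSpace ℝ (Fin n) := X

/-- The vector tangent to the tangent bundle at `p = (x, y)` with components `(ẋ, ẏ)`. -/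
def ofComps {n : ℕ} {M : Type*} [TopologicalSpace M] [ChartedSpace (EuclideanSpace ℝ (Fin n)) M]
    [IsManifold (𝓡 n) ∞ M] (p : TangentBundle (𝓡 n) M) (u v : EuclideanSpace ℝ (Fin n)) :
    TangentSpace (𝓡 n).tangent p :=
  ((u, v) : EuclideanSpace ℝ (Fin n) × EuclideanSpace ℝ (Fin n))

/-- The Liouville field `Δ = yⁱ ∂/∂yⁱ`. -/
def liouville (n : ℕ) (M : Type*) [TopologicalSpace M]
    [ChartedSpace (EuclideanSpace ℝ (Fin n)) M] [IsManifold (𝓡 n) ∞ M]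
    (p : TangentBundle (𝓡 n) M) : TangentSpace (𝓡 n).tangent p :=
  ofComps p 0 p.2

/-- A spray: a smooth vector field `Γ` on the slit tangent bundle with `τ_* Γ_(x,y) = y` and
`[Δ, Γ] = Γ`.  (Values on the zero section are irrelevant.) -/
structure IsSpray {n : ℕ} {M : Type*} [TopologicalSpace M]
    [ChartedSpace (EuclideanSpace ℝ (Fin n)) M] [IsManifold (𝓡 n) ∞ M]
    (Γ : ∀ p : TangentBundle (𝓡 n) M, TangentSpace (𝓡 n).tangent p) : Prop where
  smooth : ContMDiffOn (𝓡 n).tangent (𝓡 n).tangent.tangent ∞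
    (fun p ↦ (⟨p, Γ p⟩ : TangentBundle (𝓡 n).tangent (TangentBundle (𝓡 n) M))) (slit n M)
  secondOrder : ∀ p ∈ slit n M,
    mfderiv (𝓡 n).tangent (𝓡 n) (fun q : TangentBundle (𝓡 n) M ↦ q.1) p (Γ p) = p.2
  homogeneous : ∀ p ∈ slit n M,
    VectorField.mlieBracket (𝓡 n).tangent (liouville n M) Γ p = Γ p

/-- The fibre-derivative coefficients of the spray.  In natural coordinates
`Γ = yⁱ ∂/∂xⁱ - 2 Γⁱ ∂/∂yⁱ`, and this is the endomorphism `v ↦ Γⁱ_j vʲ` of `T_x M`, where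
`Γⁱ_j = ∂Γⁱ/∂yʲ`.  All points `(x, w)` of one fibre use the same chart. -/
def connCoeff {n : ℕ} {M : Type*} [TopologicalSpace M]
    [ChartedSpace (EuclideanSpace ℝ (Fin n)) M] [IsManifold (𝓡 n) ∞ M]
    (Γ : ∀ p : TangentBundle (𝓡 n) M, TangentSpace (𝓡 n).tangent p)
    (p : TangentBundle (𝓡 n) M) :
    EuclideanSpace ℝ (Fin n) →L[ℝ] EuclideanSpace ℝ (Fin n) :=
  fderiv ℝ (fun w : EuclideanSpace ℝ (Fin n) ↦
    -(1 / 2 : ℝ) • (comps (Γ (⟨p.1, w⟩ : TangentBundle (𝓡 n) M))).2) p.2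

/-- The vertical 1-forms `φⁱ = dyⁱ + Γⁱ_j dxʲ` dual to the basis `{H_i, V_i}`, where
`H_i = ∂/∂xⁱ - Γʲ_i ∂/∂yʲ` and `V_i = ∂/∂yⁱ`. -/
def vertForm {n : ℕ} {M : Type*} [TopologicalSpace M]
    [ChartedSpace (EuclideanSpace ℝ (Fin n)) M] [IsManifold (𝓡 n) ∞ M]
    (Γ : ∀ p : TangentBundle (𝓡 n) M, TangentSpace (𝓡 n).tangent p)
    (p : TangentBundle (𝓡 n) M) (X : TangentSpace (𝓡 n).tangent p) : TangentSpace (𝓡 n) p.1 :=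
  (comps X).2 + connCoeff Γ p (comps X).1

/-- A symmetric multiplier: a smooth symmetric `(0,2)` tensor field along the projection of the
slit tangent bundle.  Smoothness is smoothness of the components `h_ij(x, y)` in all charts. -/
structure IsSymmMultiplier {n : ℕ} {M : Type*} [TopologicalSpace M]
    [ChartedSpace (EuclideanSpace ℝ (Fin n)) M] [IsManifold (𝓡 n) ∞ M]
    (h : ∀ p : TangentBundle (𝓡 n) M,
      TangentSpace (𝓡 n) p.1 →L[ℝ] TangentSpace (𝓡 n) p.1 →L[ℝ] ℝ) : Prop where
  smooth : ∀ (x₀ : M) (a b : EuclideanSpace ℝ (Fin n)),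
    let ψ := (extChartAt (𝓡 n) x₀).symm
    let dψ (u : EuclideanSpace ℝ (Fin n)) :
        EuclideanSpace ℝ (Fin n) →L[ℝ] TangentSpace (𝓡 n) (ψ u) :=
      mfderiv 𝓘(ℝ, EuclideanSpace ℝ (Fin n)) (𝓡 n) ψ u
    ContDiffOn ℝ ∞
      (fun q : EuclideanSpace ℝ (Fin n) × EuclideanSpace ℝ (Fin n) ↦
        h (⟨ψ q.1, dψ q.1 q.2⟩ : TangentBundle (𝓡 n) M) (dψ q.1 a) (dψ q.1 b))
      ((extChartAt (𝓡 n) x₀).target ×ˢ {0}ᶜ)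
  symm : ∀ p ∈ slit n M, ∀ v w, h p v w = h p w v

/-- `h` is everywhere positive quasi-definite: `h_(x,y)(v, v) ≥ 0`, with equality only if `v` is a
scalar multiple of `y`. -/
def IsPosQuasiDef {n : ℕ} {M : Type*} [TopologicalSpace M]
    [ChartedSpace (EuclideanSpace ℝ (Fin n)) M] [IsManifold (𝓡 n) ∞ M]
    (h : ∀ p : TangentBundle (𝓡 n) M,
      TangentSpace (𝓡 n) p.1 →L[ℝ] TangentSpace (𝓡 n) p.1 →L[ℝ] ℝ) : Prop :=
  ∀ p ∈ slit n M, ∀ v : TangentSpace (𝓡 n) p.1,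
    0 ≤ h p v v ∧ (h p v v = 0 → ∃ c : ℝ, v = c • p.2)

/-- The Kähler lift `ω = h_ij dxⁱ ∧ φʲ` of `h`, as a function of two tangent vectors. -/
def kahlerLift {n : ℕ} {M : Type*} [TopologicalSpace M]
    [ChartedSpace (EuclideanSpace ℝ (Fin n)) M] [IsManifold (𝓡 n) ∞ M]
    (Γ : ∀ p : TangentBundle (𝓡 n) M, TangentSpace (𝓡 n).tangent p)
    (h : ∀ p : TangentBundle (𝓡 n) M,
      TangentSpace (𝓡 n) p.1 →L[ℝ] TangentSpace (𝓡 n) p.1 →L[ℝ] ℝ)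
    (p : TangentBundle (𝓡 n) M) (X Y : TangentSpace (𝓡 n).tangent p) : ℝ :=
  h p (comps X).1 (vertForm Γ p Y) - h p (comps Y).1 (vertForm Γ p X)

/-- `π` exhibits the manifold `P` of dimension `2n - 2` as the path space of the spray: it is a
smooth surjective submersion of the slit tangent bundle whose fibres are the leaves of the
foliation tangent to `D = span {Γ, Δ}`, i.e. they are connected and tangent to `D`.
(Values of `π` on the zero section are irrelevant.) -/
structure IsPathSpace {n : ℕ} {M : Type*} [TopologicalSpace M]
    [ChartedSpace (EuclideanSpace ℝ (Fin n)) M] [IsManifold (𝓡 n) ∞ M]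
    {P : Type*} [TopologicalSpace P] [ChartedSpace (EuclideanSpace ℝ (Fin (2 * n - 2))) P]
    [IsManifold (𝓡 (2 * n - 2)) ∞ P]
    (Γ : ∀ p : TangentBundle (𝓡 n) M, TangentSpace (𝓡 n).tangent p)
    (π : TangentBundle (𝓡 n) M → P) : Prop where
  smooth : ContMDiffOn (𝓡 n).tangent (𝓡 (2 * n - 2)) ∞ π (slit n M)
  surjOn : SurjOn π (slit n M) univ
  submersion : ∀ p ∈ slit n M,
    Function.Surjective (mfderiv (𝓡 n).tangent (𝓡 (2 * n - 2)) π p)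
  ker : ∀ p ∈ slit n M, ∀ X : TangentSpace (𝓡 n).tangent p,
    mfderiv (𝓡 n).tangent (𝓡 (2 * n - 2)) π p X = 0 ↔
      X ∈ Submodule.span ℝ {Γ p, liouville n M p}
  connected : ∀ z : P, IsConnected {p ∈ slit n M | π p = z}

/-- The representative of a differential form in the chart at `z₀`. -/
def formInChart {m k : ℕ} {P : Type*} [TopologicalSpace P]
    [ChartedSpace (EuclideanSpace ℝ (Fin m)) P] [IsManifold (𝓡 m) ∞ P]
    (Ω : ∀ z : P, TangentSpace (𝓡 m) z [⋀^Fin k]→L[ℝ] ℝ) (z₀ : P)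
    (u : EuclideanSpace ℝ (Fin m)) : EuclideanSpace ℝ (Fin m) [⋀^Fin k]→L[ℝ] ℝ :=
  (Ω ((extChartAt (𝓡 m) z₀).symm u)).compContinuousLinearMap
    (mfderiv 𝓘(ℝ, EuclideanSpace ℝ (Fin m)) (𝓡 m) (extChartAt (𝓡 m) z₀).symm u)

/-- A symplectic form: a smooth, closed, non-degenerate 2-form. -/
structure IsSymplectic {m : ℕ} {P : Type*} [TopologicalSpace P]
    [ChartedSpace (EuclideanSpace ℝ (Fin m)) P] [IsManifold (𝓡 m) ∞ P]
    (Ω : ∀ z : P, TangentSpace (𝓡 m) z [⋀^Fin 2]→L[ℝ] ℝ) : Prop where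
  smooth : ∀ z₀ : P, ContDiffOn ℝ ∞ (formInChart Ω z₀) (extChartAt (𝓡 m) z₀).target
  closed : ∀ z₀ : P, ∀ u ∈ (extChartAt (𝓡 m) z₀).target, extDeriv (formInChart Ω z₀) u = 0
  nondegenerate : ∀ (z : P) (ξ : TangentSpace (𝓡 m) z), (∀ η, Ω z ![ξ, η] = 0) → ξ = 0

/-- `N` is an embedded `k`-dimensional submanifold: around each of its points there is a chart of
the smooth structure in which `N` is a `k`-dimensional linear slice. -/
def IsEmbeddedSubmanifold (n : ℕ) {M : Type*} [TopologicalSpace M]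
    [ChartedSpace (EuclideanSpace ℝ (Fin n)) M] (k : ℕ) (N : Set M) : Prop :=
  ∀ x ∈ N, ∃ φ ∈ IsManifold.maximalAtlas (𝓡 n) ∞ M, x ∈ φ.source ∧
    ∃ F : Submodule ℝ (EuclideanSpace ℝ (Fin n)), finrank ℝ F = k ∧
      ∀ z ∈ φ.source, z ∈ N ↔ φ z ∈ F

/-- The vectors tangent at `x` to a subset `S` of a manifold: the velocities at `x` of curves
lying in `S`.  If `S` is an embedded submanifold, this is its tangent space at `x`. -/
def tangentVectors {E : Type*} [NormedAddCommGroup E] [NormedSpace ℝ E] {H : Type*}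
    [TopologicalSpace H] (I : ModelWithCorners ℝ E H) {X : Type*} [TopologicalSpace X]
    [ChartedSpace H X] (S : Set X) (x : X) : Set (TangentSpace I x) :=
  {v | ∃ c : ℝ → X, (∀ᶠ t in 𝓝 (0 : ℝ), c t ∈ S) ∧ MDifferentiableAt 𝓘(ℝ, ℝ) I c 0 ∧
    tangentMap 𝓘(ℝ, ℝ) I c ⟨0, (1 : ℝ)⟩ = ⟨x, v⟩}

/-- The submanifold `N̂ = {(x, y) : x ∈ N, y ∈ T_x N, y ≠ 0}` of the slit tangent bundle. -/
def hatSet {n : ℕ} {M : Type*} [TopologicalSpace M]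
    [ChartedSpace (EuclideanSpace ℝ (Fin n)) M] [IsManifold (𝓡 n) ∞ M] (N : Set M) :
    Set (TangentBundle (𝓡 n) M) :=
  {p | p.1 ∈ N ∧ p.2 ∈ tangentVectors (𝓡 n) N p.1 ∧ p ∈ slit n M}

/-- `N` is a two-dimensional totally-geodesic submanifold: it is a properly embedded (i.e. closed
and embedded) surface and `Γ` is tangent to `N̂`. -/
structure IsTotallyGeodesicSurface {n : ℕ} {M : Type*} [TopologicalSpace M]
    [ChartedSpace (EuclideanSpace ℝ (Fin n)) M] [IsManifold (𝓡 n) ∞ M]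
    (Γ : ∀ p : TangentBundle (𝓡 n) M, TangentSpace (𝓡 n).tangent p) (N : Set M) : Prop where
  isClosed : IsClosed N
  embedded : IsEmbeddedSubmanifold n 2 N
  tangent : ∀ p ∈ hatSet N, Γ p ∈ tangentVectors (𝓡 n).tangent (hatSet N) p

/-- The pull-back of the 2-form `Ω` to the surface `S` is a volume form: at each point of `S` the
tangent vectors of `S` form a two-dimensional space, on which `Ω` does not vanish. -/
def IsVolumeFormOn {m : ℕ} {P : Type*} [TopologicalSpace P]
    [ChartedSpace (EuclideanSpace ℝ (Fin m)) P] [IsManifold (𝓡 m) ∞ P]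
    (Ω : ∀ z : P, TangentSpace (𝓡 m) z [⋀^Fin 2]→L[ℝ] ℝ) (S : Set P) : Prop :=
  ∀ z ∈ S, ∃ W : Submodule ℝ (TangentSpace (𝓡 m) z), finrank ℝ W = 2 ∧
    (W : Set (TangentSpace (𝓡 m) z)) = tangentVectors (𝓡 m) S z ∧
    ∃ ξ ∈ W, ∃ η ∈ W, Ω z ![ξ, η] ≠ 0

end

/-!
The form `Ω` on the path space is read off from `h` on one pair of vectors.  Let `N` be a
two-dimensional totally-geodesic submanifold, `p = (x, y)` a point of `N̂`, and `e ∈ T_x N`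
independent of `y`.  The four-dimensional space tangent to `N̂` at `p` is spanned by `Γ`, `Δ`, a
vector `X` over `e`, and the vertical lift `e^V` of `e`.  The first two span the kernel of `dπ`, and
`ω(X, e^V) = h_p(e, e)`, because vertical lifts are paired with vectors of the base through `h`
alone.  So `dπ X`, `dπ e^V` form a basis of `dπ (T_p N̂)`, and `Ω` is nonzero on that plane exactly
if `h_p(e, e) ≠ 0`.

It remains to identify `dπ (T_p N̂)` with the tangent vectors of `N̄ = π(N̂)` at `π(p)`
(`IsTotallyGeodesicSurface.tangentVectors_image`).  Images of tangent vectors are tangent vectors;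
conversely a curve in `N̄` is lifted by a local section of `π`, and the lift stays in `N̂` because
`N̂` is a union of fibres of `π` (`IsTotallyGeodesicSurface.mem_hatSet_of_eq`).  Each fibre is
connected, and `N̂` is closed in it, as `N` is closed; it is also open in it, which is a local
statement about a submersion and a linear slice containing the kernels of its differential at its
own points (`eventually_fiber_subset`): along a line in a straightened fibre the distance to the
slice satisfies a linear differential inequality, and Grönwall's inequality applies.

Positivity of `h` therefore gives a volume form on every `N̄`.  Conversely, if every `N̄` carries a
volume form, then `h_p(e, e) ≠ 0` for all `e` independent of `y`, since every plane is tangent to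
some `N`.  The sign is then constant (`IsSymmMultiplier.pos_or_neg`): for fixed `x`, as `n ≥ 3`, any
two independent pairs `(y, e)` are joined by changing one vector at a time within the complement of
a line; and along `M` the sign is locally constant and `M` is connected.  Finally `h_p(y, y) = 0`
(`apply_velocity_eq_zero`), because `Γ` is in the kernel of `dπ`.
-/

/-! ### Submersions of vector spaces -/

section NormedSpace

variable {E E' : Type*} [NormedAddCommGroup E] [NormedSpace ℝ E] [FiniteDimensional ℝ E]
  [NormedAddCommGroup E'] [NormedSpace ℝ E'] [FiniteDimensional ℝ E']

/-- A submersion is, in suitable local coordinates, the projection onto the first factor.  The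
second factor is the kernel of the differential, reached by a linear projection. -/
theorem exists_straightening {f : E → E'} {p : E} (hf : ContDiffAt ℝ 2 f p)
    (hsurj : Function.Surjective (fderiv ℝ f p)) :
    ∃ Ψ : OpenPartialHomeomorph E (E' × (fderiv ℝ f p).ker), p ∈ Ψ.source ∧
      (∀ q, (Ψ q).1 = f q) ∧ ContDiffAt ℝ 2 Ψ p ∧ ContDiffAt ℝ 2 Ψ.symm (Ψ p) := by
  have : CompleteSpace E := FiniteDimensional.complete ℝ E
  have : CompleteSpace E' := FiniteDimensional.complete ℝ E'
  obtain ⟨κ, hκ⟩ : ((fderiv ℝ f p).ker).ClosedComplemented :=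
    Submodule.ClosedComplemented.of_finiteDimensional _
  let A : E →L[ℝ] E' × (fderiv ℝ f p).ker := (fderiv ℝ f p).prod κ
  have hbij : Function.Bijective A := by
    constructor
    · refine (injective_iff_map_eq_zero A).2 fun x hx ↦ ?_
      have h1 : fderiv ℝ f p x = 0 := congrArg Prod.fst hx
      have h2 : κ x = 0 := congrArg Prod.snd hx
      have h3 := hκ ⟨x, h1⟩
      rw [h2] at h3
      exact (congrArg Subtype.val h3).symm
    · rintro ⟨b, k⟩
      obtain ⟨x, rfl⟩ := hsurj b
      refine ⟨x + (k - κ x : (fderiv ℝ f p).ker), Prod.ext ?_ ?_⟩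
      · have : fderiv ℝ f p ((k - κ x : (fderiv ℝ f p).ker) : E) = 0 := (k - κ x).2
        change fderiv ℝ f p (x + (k - κ x : (fderiv ℝ f p).ker)) = _
        rw [map_add, this, add_zero]
      · change κ (x + (k - κ x : (fderiv ℝ f p).ker)) = _
        rw [map_add, hκ]; abel
  let e : E ≃L[ℝ] E' × (fderiv ℝ f p).ker :=
    ContinuousLinearEquiv.ofBijective A (LinearMap.ker_eq_bot.2 hbij.1)
      (LinearMap.range_eq_top.2 hbij.2)
  have hd : ContDiffAt ℝ 2 (fun q ↦ (f q, κ q)) p := hf.prodMk κ.contDiff.contDiffAt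
  have hd' : HasFDerivAt (fun q ↦ (f q, κ q)) (e : E →L[ℝ] E' × (fderiv ℝ f p).ker) p := by
    have : (e : E →L[ℝ] E' × (fderiv ℝ f p).ker) = A := by ext <;> rfl
    rw [this]
    exact (hf.differentiableAt (by simp)).hasFDerivAt.prodMk κ.hasFDerivAt
  exact ⟨hd.toOpenPartialHomeomorph _ hd' (by simp), hd.mem_toOpenPartialHomeomorph_source hd' _,
    fun _ ↦ rfl, hd, hd.to_localInverse hd' (by simp)⟩

/-- A submersion has a local section through every point. -/
theorem exists_local_section {f : E → E'} {p : E} (hf : ContDiffAt ℝ 2 f p)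
    (hsurj : Function.Surjective (fderiv ℝ f p)) :
    ∃ s : E' → E, DifferentiableAt ℝ s (f p) ∧ s (f p) = p ∧ ∀ᶠ w in 𝓝 (f p), f (s w) = w := by
  obtain ⟨Ψ, hp, hΨ, -, hsymm⟩ := exists_straightening hf hsurj
  have hpt : (f p, (Ψ p).2) = Ψ p := Prod.ext (hΨ p).symm rfl
  refine ⟨fun w ↦ Ψ.symm (w, (Ψ p).2), ?_, ?_, ?_⟩
  · refine DifferentiableAt.comp (f p) (g := Ψ.symm) ?_ (by fun_prop)
    rw [hpt]
    exact hsymm.differentiableAt (by simp)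
  · simp only [hpt, Ψ.left_inv hp]
  · have hc : ContinuousAt (fun w : E' ↦ (w, (Ψ p).2)) (f p) := by fun_prop
    have ht : Ψ.target ∈ 𝓝 (f p, (Ψ p).2) := by
      rw [hpt]; exact Ψ.open_target.mem_nhds (Ψ.map_source hp)
    filter_upwards [hc.preimage_mem_nhds ht] with w hw
    rw [← hΨ, Ψ.right_inv hw]

/-- If a linear subspace contains the kernel of the differential of a submersion at each of its
own points, then it contains the fibres through its points, locally.  The distance to the subspace
along a line inside a straightened fibre satisfies a linear differential inequality, so Grönwall's
inequality forces it to vanish. -/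
theorem eventually_fiber_subset {f : E → E'} {p : E} (hf : ContDiffAt ℝ 2 f p)
    (hsurj : Function.Surjective (fderiv ℝ f p)) {G : Submodule ℝ E} (hpG : p ∈ G)
    (hker : ∀ᶠ q in 𝓝 p, q ∈ G → ∀ x, fderiv ℝ f q x = 0 → x ∈ G) :
    ∀ᶠ q in 𝓝 p, f q = f p → q ∈ G := by
  obtain ⟨Ψ, hp, hΨ, hto, hsymm⟩ := exists_straightening hf hsurj
  obtain ⟨P, hP⟩ : G.ClosedComplemented := Submodule.ClosedComplemented.of_finiteDimensional _
  obtain ⟨R, hR⟩ : ∃ R : E →L[ℝ] E, ∀ x, R x = x - P x :=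
    ⟨ContinuousLinearMap.id ℝ E - G.subtypeL.comp P, fun x ↦ rfl⟩
  have hRG : ∀ x ∈ G, R x = 0 := fun x hx ↦ by
    rw [hR, hP ⟨x, hx⟩, sub_self]
  have hR0 : ∀ x, R x = 0 → x ∈ G := fun x hx ↦ by
    rw [hR, sub_eq_zero] at hx; rw [hx]; exact (P x).2
  let B : E → (E' × (fderiv ℝ f p).ker) →L[ℝ] E := fun q ↦ fderiv ℝ Ψ.symm (Ψ q)
  have hB : ContDiffAt ℝ 1 B p := by
    have h1 : ContDiffAt ℝ 1 (fderiv ℝ Ψ.symm) (Ψ p) :=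
      hsymm.fderiv_right (by norm_num)
    exact h1.comp p (hto.of_le (by norm_num))
  obtain ⟨C, T, hT, hLip⟩ := hB.exists_lipschitzOnWith
  -- On a neighbourhood `U` the field `q ↦ B q (0, k)` is defined, tangent to the fibres of `f`,
  -- and hence tangent to `G` along `G`.
  have hU : ∀ᶠ q in 𝓝 p, q ∈ T ∧ DifferentiableAt ℝ Ψ.symm (Ψ q) ∧
      (q ∈ G → ∀ k, B q (0, k) ∈ G) := by
    have hd : ∀ᶠ w in 𝓝 (Ψ p), DifferentiableAt ℝ Ψ.symm w :=
      (hsymm.eventually (by simp)).mono fun w hw ↦ hw.differentiableAt (by simp)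
    have hd' : ∀ᶠ q in 𝓝 p, DifferentiableAt ℝ f q :=
      (hf.eventually (by simp)).mono fun w hw ↦ hw.differentiableAt (by simp)
    filter_upwards [hT, hto.continuousAt.eventually hd, hd', hker,
      Ψ.open_source.mem_nhds hp] with q h1 h2 h3 h4 h5
    refine ⟨h1, h2, fun hq k ↦ h4 hq _ ?_⟩
    have hcomp : HasFDerivAt (fun w ↦ f (Ψ.symm w)) ((fderiv ℝ f q).comp (B q)) (Ψ q) := by
      refine HasFDerivAt.comp (Ψ q) (g := f) ?_ h2.hasFDerivAt
      rw [Ψ.left_inv h5]; exact h3.hasFDerivAt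
    have hfst : HasFDerivAt (fun w ↦ f (Ψ.symm w)) (ContinuousLinearMap.fst ℝ E' _) (Ψ q) := by
      refine hasFDerivAt_fst.congr_of_eventuallyEq ?_
      filter_upwards [Ψ.open_target.mem_nhds (Ψ.map_source h5)] with w hw
      rw [← hΨ, Ψ.right_inv hw]
    exact congrArg (fun L : _ →L[ℝ] E' ↦ L (0, k)) (hcomp.unique hfst)
  have hPc : Tendsto (fun q ↦ (P q : E)) (𝓝 p) (𝓝 p) := by
    have : ContinuousAt (fun q ↦ (P q : E)) p := by fun_prop
    simpa only [ContinuousAt, hP ⟨p, hpG⟩] using this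
  have hsc : Tendsto Ψ.symm (𝓝 (Ψ p)) (𝓝 p) := by
    simpa only [ContinuousAt, Ψ.left_inv hp] using hsymm.continuousAt
  obtain ⟨ε, hε, hball⟩ := Metric.eventually_nhds_iff_ball.1
    ((Ψ.open_target.eventually_mem (Ψ.map_source hp)).and (hsc.eventually (hU.and (hPc.eventually hU))))
  filter_upwards [Ψ.open_source.mem_nhds hp,
    hto.continuousAt.eventually (Metric.ball_mem_nhds _ hε)] with q hq hqb hfq
  have hline : ∀ t ∈ Icc (0 : ℝ) 1, Ψ p + t • (Ψ q - Ψ p) ∈ Metric.ball (Ψ p) ε := fun t ht ↦ by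
    have := (convex_ball (Ψ p) ε).add_smul_sub_mem (Metric.mem_ball_self hε) hqb ht
    simpa using this
  set k := (Ψ q - Ψ p).2
  have hk : Ψ q - Ψ p = (0, k) := Prod.ext (by simp [hΨ, hfq]) rfl
  have hder : ∀ t ∈ Icc (0 : ℝ) 1, HasDerivAt (fun t : ℝ ↦ R (Ψ.symm (Ψ p + t • (Ψ q - Ψ p))))
      (R (B (Ψ.symm (Ψ p + t • (Ψ q - Ψ p))) (0, k))) t := fun t ht ↦ by
    obtain ⟨h1, ⟨h2, h3, h4⟩, -⟩ := hball _ (hline t ht)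
    rw [Ψ.right_inv h1] at h3
    have hl : HasDerivAt (fun t : ℝ ↦ Ψ p + t • (Ψ q - Ψ p)) (0, k) t := by
      rw [hk]
      simpa using ((hasDerivAt_id' t).smul_const ((0 : E'), k)).const_add (Ψ p)
    have := h3.hasFDerivAt.comp_hasDerivAt t hl
    simp only [B, Ψ.right_inv h1]
    exact R.hasFDerivAt.comp_hasDerivAt t this
  have hzero := eq_zero_of_abs_deriv_le_mul_abs_self_of_eq_zero_right
    (f := fun t : ℝ ↦ R (Ψ.symm (Ψ p + t • (Ψ q - Ψ p))))
    (f' := fun t : ℝ ↦ R (B (Ψ.symm (Ψ p + t • (Ψ q - Ψ p))) (0, k)))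
    (K := ‖R‖ * (C * ‖((0 : E'), k)‖)) (a := 0) (b := 1)
    (fun t ht ↦ (hder t ht).continuousAt.continuousWithinAt)
    (fun t ht ↦ (hder t (Ico_subset_Icc_self ht)).hasDerivWithinAt)
    (by simpa [Ψ.left_inv hp] using hRG p hpG)
    (fun t ht ↦ by
      obtain ⟨h1, ⟨h2, h3, h4⟩, h5, -, h6⟩ := hball _ (hline t (Ico_subset_Icc_self ht))
      set x := Ψ.symm (Ψ p + t • (Ψ q - Ψ p))
      have hx : R (B x (0, k)) = R ((B x - B (P x)) (0, k)) := by
        have h7 := hRG _ (h6 (P x).2 k)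
        rw [sub_apply, R.map_sub, h7, sub_zero]
      have hl := hLip.dist_le_mul x h2 _ h5
      rw [dist_eq_norm, dist_eq_norm, ← hR] at hl
      calc ‖R (B x (0, k))‖ ≤ ‖R‖ * (‖B x - B (P x)‖ * ‖((0 : E'), k)‖) := by
            rw [hx]
            exact (R.le_opNorm _).trans (by gcongr; exact ContinuousLinearMap.le_opNorm _ _)
        _ ≤ ‖R‖ * ((C * ‖R x‖) * ‖((0 : E'), k)‖) := by gcongr
        _ = _ := by ring)
  have := hzero 1 (by simp)
  simp only [one_smul, add_sub_cancel, Ψ.left_inv hq] at this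
  exact hR0 q this

end NormedSpace

/-! ### Tangent vectors of subsets, slices and submersions of manifolds -/

section TangentVectors

variable {E : Type*} [NormedAddCommGroup E] [NormedSpace ℝ E] {H : Type*} [TopologicalSpace H]
  {I : ModelWithCorners ℝ E H} {X : Type*} [TopologicalSpace X] [ChartedSpace H X]
  {E' : Type*} [NormedAddCommGroup E'] [NormedSpace ℝ E'] {H' : Type*} [TopologicalSpace H']
  {I' : ModelWithCorners ℝ E' H'} {Y : Type*} [TopologicalSpace Y] [ChartedSpace H' Y]
  {V : Type*} [NormedAddCommGroup V] [NormedSpace ℝ V] [FiniteDimensional ℝ V]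

/-- Tangent vectors are pushed forward by a differentiable map that sends one set into another. -/
theorem tangentMap_mem_tangentVectors {S : Set X} {S' : Set Y} {f : X → Y} {x : X} {y : Y}
    {v : TangentSpace I x} {w : TangentSpace I' y} (hf : MDifferentiableAt I I' f x)
    (hS : ∀ᶠ z in 𝓝 x, z ∈ S → f z ∈ S') (hv : v ∈ tangentVectors I S x)
    (hw : tangentMap I I' f ⟨x, v⟩ = ⟨y, w⟩) : w ∈ tangentVectors I' S' y := by
  obtain ⟨c, hc, hcd, hcv⟩ := hv
  have h0 : c 0 = x := congrArg Bundle.TotalSpace.proj hcv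
  have hf' : MDifferentiableAt I I' f (c 0) := h0 ▸ hf
  refine ⟨f ∘ c, ?_, hf'.comp 0 hcd, ?_⟩
  · rw [← h0] at hS
    filter_upwards [hc, hcd.continuousAt.eventually hS] with t h1 h2 using h2 h1
  · rw [tangentMap_comp_at _ hf' hcd, hcv, hw]

/-- A map that is locally the identity fixes tangent vectors, as points of the tangent bundle. -/
theorem tangentMap_eq_self {f : X → X} {x : X} (hf : f =ᶠ[𝓝 x] id) (v : TangentSpace I x) :
    tangentMap I I f ⟨x, v⟩ = ⟨x, v⟩ := by
  have h : (mfderiv I I f x : E →L[ℝ] E) v = v :=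
    congrArg (fun L : E →L[ℝ] E ↦ L v) ((hasMFDerivAt_id x).congr_of_eventuallyEq hf).mfderiv
  calc tangentMap I I f ⟨x, v⟩ = ⟨f x, (v : E)⟩ :=
        congrArg (fun w : E ↦ (⟨f x, w⟩ : TangentBundle I X)) h
    _ = ⟨x, v⟩ := congrArg (fun z : X ↦ (⟨z, (v : E)⟩ : TangentBundle I X)) hf.self_of_nhds

omit [FiniteDimensional ℝ V] in
/-- In a vector space the velocity used in `tangentVectors` is the ordinary derivative. -/
theorem tangentMap_one_eq_iff {c : ℝ → V} (hc : DifferentiableAt ℝ c 0) {u v : V} :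
    tangentMap 𝓘(ℝ, ℝ) 𝓘(ℝ, V) c ⟨0, (1 : ℝ)⟩ = (⟨u, v⟩ : TangentBundle 𝓘(ℝ, V) V) ↔
      c 0 = u ∧ HasDerivAt c v 0 := by
  have h1 : (mfderiv 𝓘(ℝ, ℝ) 𝓘(ℝ, V) c 0 : ℝ →L[ℝ] V) 1 = deriv c 0 := by
    rw [mfderiv_eq_fderiv]; rfl
  constructor
  · intro h
    have h2 : deriv c 0 = v := by
      rw [← h1]; exact congrArg (fun q : TangentBundle 𝓘(ℝ, V) V ↦ (q.2 : V)) h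
    exact ⟨congrArg Bundle.TotalSpace.proj h, h2 ▸ hc.hasDerivAt⟩
  · rintro ⟨rfl, h⟩
    rw [← h.deriv, ← h1]
    rfl

/-- The tangent vectors of a linear subspace at any of its points form the subspace itself. -/
theorem mem_tangentVectors_submodule {G : Submodule ℝ V} {u v : V} (hu : u ∈ G) :
    v ∈ tangentVectors 𝓘(ℝ, V) (G : Set V) u ↔ v ∈ G := by
  constructor
  · rintro ⟨c, hc, hcd, hcv⟩
    obtain ⟨-, hd⟩ := (tangentMap_one_eq_iff hcd.differentiableAt).1 hcv
    obtain ⟨P, hP⟩ : G.ClosedComplemented := Submodule.ClosedComplemented.of_finiteDimensional _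
    -- `c` agrees near `0` with its projection to `G`, so the two derivatives agree.
    have h1 : HasDerivAt (fun t ↦ (P (c t) : V)) (P v : V) 0 :=
      ((G.subtypeL.comp P).hasFDerivAt.comp_hasDerivAt (0 : ℝ) hd)
    have h2 : HasDerivAt c (P v : V) 0 := h1.congr_of_eventuallyEq <| by
      filter_upwards [hc] with t ht
      rw [hP ⟨c t, ht⟩]
    rw [hd.unique h2]
    exact (P v).2
  · intro hv
    have hd : HasDerivAt (fun t : ℝ ↦ u + t • v) v 0 := by
      simpa using ((hasDerivAt_id' (0 : ℝ)).smul_const v).const_add u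
    exact ⟨fun t ↦ u + t • v, Eventually.of_forall fun t ↦ G.add_mem hu (G.smul_mem t hv),
      hd.differentiableAt.mdifferentiableAt,
      (tangentMap_one_eq_iff hd.differentiableAt).2 ⟨by simp, hd⟩⟩

/-- A smooth local coordinate system of a manifold, with values in an arbitrary vector space `V`
rather than in the model space of the manifold. -/
structure IsSmoothCoord (I : ModelWithCorners ℝ E H) (e : OpenPartialHomeomorph X V) : Prop where
  smooth : ContMDiffOn I 𝓘(ℝ, V) ∞ e e.source
  smooth_symm : ContMDiffOn 𝓘(ℝ, V) I ∞ e.symm e.target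

namespace IsSmoothCoord

variable {e : OpenPartialHomeomorph X V} {x : X} {u : V}

omit [FiniteDimensional ℝ V] in
theorem contMDiffAt (he : IsSmoothCoord I e) (hx : x ∈ e.source) : ContMDiffAt I 𝓘(ℝ, V) ∞ e x :=
  he.smooth.contMDiffAt (e.open_source.mem_nhds hx)

omit [FiniteDimensional ℝ V] in
theorem contMDiffAt_symm (he : IsSmoothCoord I e) (hu : u ∈ e.target) :
    ContMDiffAt 𝓘(ℝ, V) I ∞ e.symm u :=
  he.smooth_symm.contMDiffAt (e.open_target.mem_nhds hu)

omit [FiniteDimensional ℝ V] in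
theorem mdifferentiable (he : IsSmoothCoord I e) : e.MDifferentiable I 𝓘(ℝ, V) :=
  ⟨he.smooth.mdifferentiableOn (by simp), he.smooth_symm.mdifferentiableOn (by simp)⟩

omit [FiniteDimensional ℝ V] in
theorem tangentMap_symm_tangentMap (he : IsSmoothCoord I e) (hx : x ∈ e.source)
    (v : TangentSpace I x) :
    tangentMap 𝓘(ℝ, V) I e.symm (tangentMap I 𝓘(ℝ, V) e ⟨x, v⟩) = ⟨x, v⟩ := by
  rw [← tangentMap_comp_at (g := e.symm) (f := e) (⟨x, v⟩ : TangentBundle I X)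
    (he.mdifferentiable.mdifferentiableAt_symm (e.map_source hx))
    (he.mdifferentiable.mdifferentiableAt hx)]
  refine tangentMap_eq_self ?_ v
  filter_upwards [e.open_source.mem_nhds hx] with y hy using e.left_inv hy

/-- In slice coordinates the tangent vectors are those mapped into the slice. -/
theorem mem_tangentVectors_iff (he : IsSmoothCoord I e) (hx : x ∈ e.source) {S : Set X} (hxS : x ∈ S) {G : Submodule ℝ V}
    (hS : ∀ᶠ y in 𝓝 x, y ∈ S ↔ e y ∈ G) {v : TangentSpace I x} :
    v ∈ tangentVectors I S x ↔ (mfderiv I 𝓘(ℝ, V) e x v : V) ∈ G := by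
  have hxG : e x ∈ G := hS.self_of_nhds.1 hxS
  constructor
  · intro hv
    refine (mem_tangentVectors_submodule hxG).1 ?_
    exact tangentMap_mem_tangentVectors (he.mdifferentiable.mdifferentiableAt hx) (hS.mono fun y hy ↦ hy.1) hv rfl
  · intro hv
    refine tangentMap_mem_tangentVectors (he.mdifferentiable.mdifferentiableAt_symm (e.map_source hx)) ?_
      ((mem_tangentVectors_submodule hxG).2 hv) (he.tangentMap_symm_tangentMap hx v)
    have hc := e.symm.continuousAt (e.map_source hx)
    rw [ContinuousAt, e.left_inv hx] at hc
    filter_upwards [hc.eventually hS, e.open_target.mem_nhds (e.map_source hx)] with w h1 h2 h3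
    rw [h1, e.right_inv h2]
    exact h3

variable {V' : Type*} [NormedAddCommGroup V'] [NormedSpace ℝ V'] [FiniteDimensional ℝ V']
  {e' : OpenPartialHomeomorph Y V'}

omit [FiniteDimensional ℝ V] [FiniteDimensional ℝ V'] in
theorem contDiffAt_representative (he : IsSmoothCoord I e) (he' : IsSmoothCoord I' e')
    {f : X → Y} (hu : u ∈ e.target) (hf : ContMDiffAt I I' ∞ f (e.symm u))
    (hfu : f (e.symm u) ∈ e'.source) : ContDiffAt ℝ ∞ (e' ∘ f ∘ e.symm) u :=
  ((he'.contMDiffAt hfu).comp u (hf.comp u (he.contMDiffAt_symm hu))).contDiffAt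

omit [FiniteDimensional ℝ V] [FiniteDimensional ℝ V'] in
/-- The chain rule for the coordinate representative of `f`, at a point `u` of the coordinate domain
so that all differentials are taken at syntactically matching points. -/
theorem fderiv_representative (he : IsSmoothCoord I e) (he' : IsSmoothCoord I' e')
    {f : X → Y} (hu : u ∈ e.target) (hf : ContMDiffAt I I' ∞ f (e.symm u))
    (hfu : f (e.symm u) ∈ e'.source) (v : V) :
    fderiv ℝ (e' ∘ f ∘ e.symm) u v = mfderiv I' 𝓘(ℝ, V') e' (f (e.symm u))
      (mfderiv I I' f (e.symm u) (mfderiv 𝓘(ℝ, V) I e.symm u v)) := by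
  have h1 := (hf.mdifferentiableAt (by simp)).hasMFDerivAt.comp u
    (he.mdifferentiable.mdifferentiableAt_symm hu).hasMFDerivAt
  have h2 := (he'.mdifferentiable.mdifferentiableAt hfu).hasMFDerivAt.comp u h1
  rw [← mfderiv_eq_fderiv, h2.mfderiv]
  rfl

omit [FiniteDimensional ℝ V] [FiniteDimensional ℝ V'] in
theorem surjective_fderiv_representative (he : IsSmoothCoord I e) (he' : IsSmoothCoord I' e')
    {f : X → Y} (hu : u ∈ e.target) (hf : ContMDiffAt I I' ∞ f (e.symm u))
    (hfu : f (e.symm u) ∈ e'.source) (hsurj : Function.Surjective (mfderiv I I' f (e.symm u))) :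
    Function.Surjective (fderiv ℝ (e' ∘ f ∘ e.symm) u) := by
  intro w
  obtain ⟨w₁, hw₁⟩ := he'.mdifferentiable.mfderiv_surjective hfu w
  obtain ⟨w₂, rfl⟩ := hsurj w₁
  obtain ⟨w₃, rfl⟩ := he.mdifferentiable.symm.mfderiv_surjective hu w₂
  exact ⟨w₃, (he.fderiv_representative he' hu hf hfu w₃).trans hw₁⟩

/-- A submersion has a differentiable local section through every point. -/
theorem exists_local_section (he : IsSmoothCoord I e) (he' : IsSmoothCoord I' e')
    {f : X → Y} (hx : x ∈ e.source) (hfx : f x ∈ e'.source)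
    (hf : ContMDiffAt I I' ∞ f x) (hsurj : Function.Surjective (mfderiv I I' f x)) :
    ∃ s : Y → X, MDifferentiableAt I' I s (f x) ∧ s (f x) = x ∧
      ∀ᶠ w in 𝓝 (f x), f (s w) = w := by
  obtain ⟨u, hu, rfl⟩ : ∃ u ∈ e.target, e.symm u = x := ⟨e x, e.map_source hx, e.left_inv hx⟩
  have hcf := he.contDiffAt_representative he' hu hf hfx
  obtain ⟨s, hsd, hs, hsf⟩ := _root_.exists_local_section (hcf.of_le (WithTop.coe_le_coe.2 (le_top (a := (2 : ℕ∞)))))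
    (he.surjective_fderiv_representative he' hu hf hfx hsurj)
  simp only [Function.comp_apply] at hsd hs hsf
  have hsd' : MDifferentiableAt 𝓘(ℝ, V') 𝓘(ℝ, V) s (e' (f (e.symm u))) := hsd.mdifferentiableAt
  have h1 : MDifferentiableAt I' 𝓘(ℝ, V) (s ∘ e') (f (e.symm u)) :=
    hsd'.comp _ (he'.mdifferentiable.mdifferentiableAt hfx)
  have h2 : (s ∘ e') (f (e.symm u)) = u := hs
  refine ⟨e.symm ∘ (s ∘ e'), MDifferentiableAt.comp _ ?_ h1, by simp [hs], ?_⟩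
  · rw [h2]; exact he.mdifferentiable.mdifferentiableAt_symm hu
  · have hc : ContinuousAt (fun w ↦ f (e.symm (s (e' w)))) (f (e.symm u)) := by
      refine ContinuousAt.comp (g := f) ?_ (ContinuousAt.comp (g := e.symm) ?_ h1.continuousAt)
      · simpa only [Function.comp_apply, hs] using hf.continuousAt
      · simpa only [Function.comp_apply, hs] using e.symm.continuousAt hu
    have h3 : ∀ᶠ w in 𝓝 (f (e.symm u)), f (e.symm (s (e' w))) ∈ e'.source := by
      refine hc.eventually (e'.open_source.mem_nhds ?_)
      simpa only [hs] using hfx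
    filter_upwards [e'.open_source.mem_nhds hfx, h3, (e'.continuousAt hfx).eventually hsf]
      with w h4 h5 h6
    exact e'.injOn h5 h4 h6

/-- A slice that contains the kernel of the differential of a submersion at each of its points
contains the fibres through its points, locally. -/
theorem eventually_fiber_subset (he : IsSmoothCoord I e) (he' : IsSmoothCoord I' e')
    {f : X → Y} (hx : x ∈ e.source) (hfx : f x ∈ e'.source)
    (hf : ∀ᶠ z in 𝓝 x, ContMDiffAt I I' ∞ f z) (hsurj : Function.Surjective (mfderiv I I' f x))
    {S : Set X} (hxS : x ∈ S) {G : Submodule ℝ V} (hS : ∀ᶠ y in 𝓝 x, y ∈ S ↔ e y ∈ G)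
    (hker : ∀ᶠ z in 𝓝 x, z ∈ S → ∀ v : TangentSpace I z, mfderiv I I' f z v = 0 →
      v ∈ tangentVectors I S z) :
    ∀ᶠ z in 𝓝 x, f z = f x → z ∈ S := by
  obtain ⟨u, hu, rfl⟩ : ∃ u ∈ e.target, e.symm u = x := ⟨e x, e.map_source hx, e.left_inv hx⟩
  have hcf := he.contDiffAt_representative he' hu hf.self_of_nhds hfx
  have huG : u ∈ G := by simpa [e.right_inv hu] using hS.self_of_nhds.1 hxS
  have hc := e.symm.continuousAt hu
  have key : ∀ᶠ q in 𝓝 u, (e' ∘ f ∘ e.symm) q = (e' ∘ f ∘ e.symm) u → q ∈ G := by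
    refine _root_.eventually_fiber_subset (hcf.of_le (WithTop.coe_le_coe.2 (le_top (a := (2 : ℕ∞)))))
      (he.surjective_fderiv_representative he' hu hf.self_of_nhds hfx hsurj) huG ?_
    have hfs : ∀ᶠ z in 𝓝 (e.symm u), f z ∈ e'.source :=
      hf.self_of_nhds.continuousAt.eventually (e'.open_source.mem_nhds hfx)
    filter_upwards [e.open_target.mem_nhds hu, hc.eventually hf, hc.eventually hker,
      hc.eventually hS.eventually_nhds, hc.eventually hfs] with q h1 h2 h3 h4 h5 hqG v hv
    rw [he.fderiv_representative he' h1 h2 h5] at hv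
    have hv' := (injective_iff_map_eq_zero _).1 (he'.mdifferentiable.mfderiv_injective h5) _ hv
    have hqS : e.symm q ∈ S := by rw [h4.self_of_nhds, e.right_inv h1]; exact hqG
    have hm := (he.mem_tangentVectors_iff (e.map_target h1) hqS h4).1 (h3 hqS _ hv')
    have hid := DFunLike.congr_fun (he.mdifferentiable.comp_symm_deriv h1) v
    exact (show _ = v from hid) ▸ hm
  have hce := e.continuousAt hx
  rw [ContinuousAt, e.right_inv hu] at hce
  filter_upwards [hce.eventually key, e.open_source.mem_nhds hx, hS] with z h1 h2 h3 h4
  rw [h3]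
  exact h1 (by simp [e.left_inv h2, h4])

end IsSmoothCoord

end TangentVectors

/-! ### Coordinates of the tangent bundle -/

section TangentBundleCoord

variable {E : Type*} [NormedAddCommGroup E] [NormedSpace ℝ E] {M : Type*} [TopologicalSpace M]
  [ChartedSpace E M] [IsManifold 𝓘(ℝ, E) ∞ M]

/-- In natural coordinates the differential of the projection is `(ẋ, ẏ) ↦ ẋ`. -/
theorem hasMFDerivAt_tangentBundle_proj (p : TangentBundle 𝓘(ℝ, E) M) :
    HasMFDerivAt 𝓘(ℝ, E).tangent 𝓘(ℝ, E) (fun q : TangentBundle 𝓘(ℝ, E) M ↦ q.1) p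
      (ContinuousLinearMap.fst ℝ E E) := by
  refine ⟨(Bundle.contMDiff_proj (n := ∞) (IB := 𝓘(ℝ, E))
    (TangentSpace 𝓘(ℝ, E) : M → Type _)).continuous.continuousAt, ?_⟩
  have hev : ∀ᶠ u in 𝓝[range 𝓘(ℝ, E).tangent] (extChartAt 𝓘(ℝ, E).tangent p p),
      u ∈ (extChartAt 𝓘(ℝ, E).tangent p).target := extChartAt_target_mem_nhdsWithin p
  have heq : ∀ᶠ u in 𝓝[range 𝓘(ℝ, E).tangent] (extChartAt 𝓘(ℝ, E).tangent p p),
      writtenInExtChartAt 𝓘(ℝ, E).tangent 𝓘(ℝ, E) p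
        (fun q : TangentBundle 𝓘(ℝ, E) M ↦ q.1) u = u.1 := by
    filter_upwards [hev] with u hu
    simp only [mfld_simps] at hu
    have hu' : u.1 ∈ (chartAt E p.1).target := (TangentBundle.mem_chart_target_iff u p).1 hu
    simp only [writtenInExtChartAt, mfld_simps]
    exact (chartAt E p.1).right_inv hu'
  exact HasFDerivWithinAt.congr_of_eventuallyEq (f := Prod.fst) hasFDerivWithinAt_fst heq
    (heq.self_of_nhdsWithin (mem_range_self _))

/-- In natural coordinates the differential of the inclusion of a fibre is `ẏ ↦ (0, ẏ)`. -/
theorem hasMFDerivAt_tangentBundle_fiber (x : M) (w : E) :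
    HasMFDerivAt 𝓘(ℝ, E) 𝓘(ℝ, E).tangent (fun w : E ↦ (⟨x, w⟩ : TangentBundle 𝓘(ℝ, E) M)) w
      (ContinuousLinearMap.inr ℝ E E) := by
  have hchart : ∀ v : E, (chartAt (ModelProd E E) (⟨x, w⟩ : TangentBundle 𝓘(ℝ, E) M))
      (⟨x, v⟩ : TangentBundle 𝓘(ℝ, E) M) = (chartAt E x x, v) := fun v ↦
    Prod.ext rfl ((tangentBundleCore 𝓘(ℝ, E) M).coordChange_self (achart E x) x
      (mem_chart_source E x) v)
  have hsymm : ∀ v : E, (⟨x, v⟩ : TangentBundle 𝓘(ℝ, E) M) =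
      (chartAt (ModelProd E E) (⟨x, w⟩ : TangentBundle 𝓘(ℝ, E) M)).symm (chartAt E x x, v) :=
    fun v ↦ by
      rw [← hchart v, OpenPartialHomeomorph.left_inv]
      simp
  refine ⟨?_, ?_⟩
  · have : (fun v : E ↦ (⟨x, v⟩ : TangentBundle 𝓘(ℝ, E) M)) =
      (chartAt (ModelProd E E) (⟨x, w⟩ : TangentBundle 𝓘(ℝ, E) M)).symm ∘
        fun v ↦ (chartAt E x x, v) := funext hsymm
    rw [this]
    refine ContinuousAt.comp ?_ (Continuous.prodMk continuous_const continuous_id).continuousAt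
    apply OpenPartialHomeomorph.continuousAt_symm
    exact (TangentBundle.mem_chart_target_iff _ _).2
      ((chartAt E x).map_source (mem_chart_source E x))
  · have h2 : HasFDerivWithinAt (fun v : E ↦ (chartAt E x x, v))
        (ContinuousLinearMap.inr ℝ E E) univ w :=
      ((hasFDerivAt_const _ _).prodMk (hasFDerivAt_id w)).hasFDerivWithinAt
    refine HasFDerivWithinAt.mono ?_ (subset_univ _)
    exact h2.congr_of_eventuallyEq (Eventually.of_forall fun v ↦ hchart v) (hchart w)

/-- The tangent bundle of a vector space is smoothly a product. -/
theorem contMDiff_toProd : ContMDiff 𝓘(ℝ, E).tangent 𝓘(ℝ, E × E) ∞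
    (fun p : TangentBundle 𝓘(ℝ, E) E ↦ ((p.1, p.2) : E × E)) := by
  have := contMDiff_tangentBundleModelSpaceHomeomorph (I := 𝓘(ℝ, E)) (n := ∞)
  rw [← modelWithCornersSelf_prod] at this
  exact this

theorem contMDiff_ofProd : ContMDiff 𝓘(ℝ, E × E) 𝓘(ℝ, E).tangent ∞
    (fun u : E × E ↦ (⟨u.1, u.2⟩ : TangentBundle 𝓘(ℝ, E) E)) := by
  have : ContMDiff (𝓘(ℝ, E).prod 𝓘(ℝ, E)) 𝓘(ℝ, E).tangent ∞
      (tangentBundleModelSpaceHomeomorph 𝓘(ℝ, E)).symm :=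
    contMDiff_tangentBundleModelSpaceHomeomorph_symm
  rw [← modelWithCornersSelf_prod] at this
  exact this

variable {φ : OpenPartialHomeomorph M E}

omit [IsManifold 𝓘(ℝ, E) ∞ M] in
theorem isSmoothCoord_of_mem_maximalAtlas (hφ : φ ∈ IsManifold.maximalAtlas 𝓘(ℝ, E) ∞ M) :
    IsSmoothCoord 𝓘(ℝ, E) φ :=
  ⟨contMDiffOn_of_mem_maximalAtlas hφ, contMDiffOn_symm_of_mem_maximalAtlas hφ⟩

theorem IsSmoothCoord.contMDiffOn_tangent (hφ : IsSmoothCoord 𝓘(ℝ, E) φ) :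
    ContMDiffOn 𝓘(ℝ, E).tangent 𝓘(ℝ, E × E) ∞
      (fun p : TangentBundle 𝓘(ℝ, E) M ↦ ((φ p.1, mfderiv 𝓘(ℝ, E) 𝓘(ℝ, E) φ p.1 p.2) : E × E))
      (Bundle.TotalSpace.proj ⁻¹' φ.source) := by
  have h := contMDiff_toProd.comp_contMDiffOn
    (hφ.smooth.contMDiffOn_tangentMapWithin (m := ∞) (by simp) φ.open_source.uniqueMDiffOn)
  refine h.congr fun p hp ↦ ?_
  have := tangentMapWithin_eq_tangentMap (p := p) (φ.open_source.uniqueMDiffOn p.1 hp)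
    (hφ.mdifferentiable.mdifferentiableAt hp)
  exact (congrArg (fun q : TangentBundle 𝓘(ℝ, E) E ↦ ((q.1, q.2) : E × E)) this).symm

theorem IsSmoothCoord.contMDiffOn_tangent_symm (hφ : IsSmoothCoord 𝓘(ℝ, E) φ) :
    ContMDiffOn 𝓘(ℝ, E × E) 𝓘(ℝ, E).tangent ∞
      (fun u : E × E ↦ (⟨φ.symm u.1, mfderiv 𝓘(ℝ, E) 𝓘(ℝ, E) φ.symm u.1 u.2⟩ :
        TangentBundle 𝓘(ℝ, E) M)) (φ.target ×ˢ univ) := by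
  have h := (hφ.smooth_symm.contMDiffOn_tangentMapWithin (m := ∞) (by simp)
    φ.open_target.uniqueMDiffOn).comp contMDiff_ofProd.contMDiffOn (s := φ.target ×ˢ univ)
    (fun u hu ↦ hu.1)
  refine h.congr fun u hu ↦ ?_
  have := tangentMapWithin_eq_tangentMap (p := (⟨u.1, u.2⟩ : TangentBundle 𝓘(ℝ, E) E))
    (φ.open_target.uniqueMDiffOn u.1 hu.1) (hφ.mdifferentiable.mdifferentiableAt_symm hu.1)
  simp only [Function.comp_apply, this]
  rfl

/-- The coordinates `(φ x, dφ y)` of the tangent bundle induced by coordinates `φ` of the base. -/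
noncomputable def tangentCoord (hφ : IsSmoothCoord 𝓘(ℝ, E) φ) :
    OpenPartialHomeomorph (TangentBundle 𝓘(ℝ, E) M) (E × E) where
  toFun p := (φ p.1, mfderiv 𝓘(ℝ, E) 𝓘(ℝ, E) φ p.1 p.2)
  invFun u := ⟨φ.symm u.1, mfderiv 𝓘(ℝ, E) 𝓘(ℝ, E) φ.symm u.1 u.2⟩
  source := Bundle.TotalSpace.proj ⁻¹' φ.source
  target := φ.target ×ˢ univ
  map_source' p hp := ⟨φ.map_source hp, mem_univ _⟩
  map_target' u hu := φ.map_target hu.1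
  left_inv' := by
    rintro ⟨x, v⟩ hx
    exact hφ.tangentMap_symm_tangentMap hx v
  right_inv' := by
    rintro ⟨u, w⟩ ⟨hu, -⟩
    exact Prod.ext (φ.right_inv hu)
      (DFunLike.congr_fun (hφ.mdifferentiable.comp_symm_deriv hu) w)
  open_source := φ.open_source.preimage (Bundle.contMDiff_proj (n := ∞) (IB := 𝓘(ℝ, E))
    (TangentSpace 𝓘(ℝ, E) : M → Type _)).continuous
  open_target := φ.open_target.prod isOpen_univ
  continuousOn_toFun := hφ.contMDiffOn_tangent.continuousOn
  continuousOn_invFun := hφ.contMDiffOn_tangent_symm.continuousOn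

theorem isSmoothCoord_tangentCoord (hφ : IsSmoothCoord 𝓘(ℝ, E) φ) :
    IsSmoothCoord 𝓘(ℝ, E).tangent (tangentCoord hφ) :=
  ⟨hφ.contMDiffOn_tangent, hφ.contMDiffOn_tangent_symm⟩

theorem mfderiv_tangentCoord_fst (hφ : IsSmoothCoord 𝓘(ℝ, E) φ) {p : TangentBundle 𝓘(ℝ, E) M}
    (hp : p.1 ∈ φ.source) (a b : E) :
    (mfderiv 𝓘(ℝ, E).tangent 𝓘(ℝ, E × E) (tangentCoord hφ) p ((a, b) : E × E) : E × E).1 =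
      (mfderiv 𝓘(ℝ, E) 𝓘(ℝ, E) φ p.1 a : E) := by
  have h1 := ((isSmoothCoord_tangentCoord hφ).mdifferentiable.mdifferentiableAt
    (show p ∈ (tangentCoord hφ).source from hp)).hasMFDerivAt
  have h2 : HasMFDerivAt 𝓘(ℝ, E × E) 𝓘(ℝ, E) (Prod.fst : E × E → E) (tangentCoord hφ p)
    (ContinuousLinearMap.fst ℝ E E) := hasFDerivAt_fst.hasMFDerivAt
  have h3 := h2.comp p h1
  have h4 := (hφ.mdifferentiable.mdifferentiableAt hp).hasMFDerivAt.comp p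
    (hasMFDerivAt_tangentBundle_proj p)
  exact DFunLike.congr_fun (h3.mfderiv.symm.trans h4.mfderiv) ((a, b) : E × E)

theorem mfderiv_tangentCoord_vertical (hφ : IsSmoothCoord 𝓘(ℝ, E) φ)
    {p : TangentBundle 𝓘(ℝ, E) M} (hp : p.1 ∈ φ.source) (b : E) :
    (mfderiv 𝓘(ℝ, E).tangent 𝓘(ℝ, E × E) (tangentCoord hφ) p ((0, b) : E × E) : E × E) =
      (0, (mfderiv 𝓘(ℝ, E) 𝓘(ℝ, E) φ p.1 b : E)) := by
  obtain ⟨x, w₀⟩ := p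
  change E at w₀
  have h1 := ((isSmoothCoord_tangentCoord hφ).mdifferentiable.mdifferentiableAt
    (show (⟨x, w₀⟩ : TangentBundle 𝓘(ℝ, E) M) ∈ (tangentCoord hφ).source
      from hp)).hasMFDerivAt
  have h2 : HasMFDerivAt 𝓘(ℝ, E) 𝓘(ℝ, E × E) (fun w : E ↦ tangentCoord hφ ⟨x, w⟩) w₀ _ :=
    h1.comp (f := fun w : E ↦ (⟨x, w⟩ : TangentBundle 𝓘(ℝ, E) M)) w₀
      (hasMFDerivAt_tangentBundle_fiber x w₀)
  let D : E →L[ℝ] E := mfderiv 𝓘(ℝ, E) 𝓘(ℝ, E) φ x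
  have h3 : HasFDerivAt (fun w : E ↦ (φ x, D w)) ((0 : E →L[ℝ] E).prod D) w₀ :=
    (hasFDerivAt_const _ _).prodMk D.hasFDerivAt
  exact DFunLike.congr_fun (h2.mfderiv.symm.trans h3.hasMFDerivAt.mfderiv) b

end TangentBundleCoord

/-! ### The submanifold of velocities tangent to a submanifold -/

section Surfaces

variable {n : ℕ} {M : Type*} [TopologicalSpace M] [ChartedSpace (EuclideanSpace ℝ (Fin n)) M]
  [IsManifold (𝓡 n) ∞ M]

/-- The differential of the projection of the tangent bundle, `(ẋ, ẏ) ↦ ẋ`. -/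
noncomputable def baseVector (p : TangentBundle (𝓡 n) M) :
    TangentSpace (𝓡 n).tangent p →L[ℝ] TangentSpace (𝓡 n) p.1 :=
  ContinuousLinearMap.fst ℝ (EuclideanSpace ℝ (Fin n)) (EuclideanSpace ℝ (Fin n))

/-- The vertical lift `w ↦ wⁱ ∂/∂yⁱ` at `p`. -/
noncomputable def verticalLift (p : TangentBundle (𝓡 n) M) :
    TangentSpace (𝓡 n) p.1 →L[ℝ] TangentSpace (𝓡 n).tangent p :=
  ContinuousLinearMap.inr ℝ (EuclideanSpace ℝ (Fin n)) (EuclideanSpace ℝ (Fin n))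

theorem baseVector_verticalLift (p : TangentBundle (𝓡 n) M) (w : TangentSpace (𝓡 n) p.1) :
    baseVector p (verticalLift p w) = 0 := rfl

theorem verticalLift_injective (p : TangentBundle (𝓡 n) M) :
    Function.Injective (verticalLift p) := fun _ _ h ↦ congrArg Prod.snd h

theorem exists_verticalLift_eq {p : TangentBundle (𝓡 n) M} {X : TangentSpace (𝓡 n).tangent p}
    (hX : baseVector p X = 0) : ∃ w, verticalLift p w = X :=
  ⟨(comps X).2, Prod.ext hX.symm rfl⟩

theorem isSmoothCoord_chartAt (x : M) :
    IsSmoothCoord (𝓡 n) (chartAt (EuclideanSpace ℝ (Fin n)) x) :=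
  isSmoothCoord_of_mem_maximalAtlas (IsManifold.chart_mem_maximalAtlas x)

theorem isOpen_slit : IsOpen (slit n M) := by
  refine isOpen_iff_mem_nhds.2 fun p hp ↦ ?_
  have hφ := isSmoothCoord_chartAt (n := n) p.1
  have hsrc : p ∈ (tangentCoord hφ).source := mem_chart_source _ p.1
  have hiff : ∀ q ∈ (tangentCoord hφ).source, (tangentCoord hφ q).2 ≠ 0 ↔ q ∈ slit n M :=
    fun q hq ↦ (map_ne_zero_iff _ (hφ.mdifferentiable.mfderiv_injective hq))
  have hc : ContinuousAt (fun q ↦ (tangentCoord hφ q).2) p :=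
    ((tangentCoord hφ).continuousAt hsrc).snd
  filter_upwards [(tangentCoord hφ).open_source.mem_nhds hsrc,
    hc.eventually_ne ((hiff p hsrc).2 hp)] with q h1 h2 using (hiff q h1).1 h2

variable {N : Set M} {φ : OpenPartialHomeomorph M (EuclideanSpace ℝ (Fin n))}
  {F : Submodule ℝ (EuclideanSpace ℝ (Fin n))}

omit [IsManifold (𝓡 n) ∞ M] in
theorem mem_tangentVectors_slice (hφ : IsSmoothCoord (𝓡 n) φ)
    (hF : ∀ z ∈ φ.source, z ∈ N ↔ φ z ∈ F) {x : M} (hx : x ∈ φ.source) (hxN : x ∈ N)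
    (v : TangentSpace (𝓡 n) x) : v ∈ tangentVectors (𝓡 n) N x ↔
      (mfderiv (𝓡 n) (𝓡 n) φ x v : EuclideanSpace ℝ (Fin n)) ∈ F :=
  hφ.mem_tangentVectors_iff hx hxN (by
    filter_upwards [φ.open_source.mem_nhds hx] with z hz using hF z hz)

/-- In the coordinates of the tangent bundle induced by slice coordinates of `N`, the set `N̂` is a
linear slice of the slit tangent bundle. -/
theorem mem_hatSet_slice (hφ : IsSmoothCoord (𝓡 n) φ)
    (hF : ∀ z ∈ φ.source, z ∈ N ↔ φ z ∈ F) {p : TangentBundle (𝓡 n) M} (hp : p.1 ∈ φ.source)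
    (hps : p ∈ slit n M) : p ∈ hatSet N ↔ tangentCoord hφ p ∈ F.prod F := by
  constructor
  · rintro ⟨h1, h2, -⟩
    exact ⟨(hF _ hp).1 h1, (mem_tangentVectors_slice hφ hF hp h1 _).1 h2⟩
  · rintro ⟨h1, h2⟩
    have h1' := (hF _ hp).2 h1
    exact ⟨h1', (mem_tangentVectors_slice hφ hF hp h1' _).2 h2, hps⟩

theorem eventually_mem_hatSet_slice (hφ : IsSmoothCoord (𝓡 n) φ)
    (hF : ∀ z ∈ φ.source, z ∈ N ↔ φ z ∈ F) {p : TangentBundle (𝓡 n) M} (hp : p.1 ∈ φ.source)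
    (hps : p ∈ slit n M) : ∀ᶠ q in 𝓝 p, q ∈ hatSet N ↔ tangentCoord hφ q ∈ F.prod F := by
  have hp' : p ∈ (tangentCoord hφ).source := hp
  filter_upwards [(tangentCoord hφ).open_source.mem_nhds hp', isOpen_slit.mem_nhds hps]
    with q h1 h2 using mem_hatSet_slice hφ hF h1 h2

theorem mem_tangentVectors_hatSet (hφ : IsSmoothCoord (𝓡 n) φ)
    (hF : ∀ z ∈ φ.source, z ∈ N ↔ φ z ∈ F) {p : TangentBundle (𝓡 n) M} (hp : p.1 ∈ φ.source)
    (hpN : p ∈ hatSet N) (X : TangentSpace (𝓡 n).tangent p) :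
    X ∈ tangentVectors (𝓡 n).tangent (hatSet N) p ↔
      (mfderiv (𝓡 n).tangent 𝓘(ℝ, EuclideanSpace ℝ (Fin n) × EuclideanSpace ℝ (Fin n))
        (tangentCoord hφ) p X : EuclideanSpace ℝ (Fin n) × EuclideanSpace ℝ (Fin n)) ∈ F.prod F :=
  (isSmoothCoord_tangentCoord hφ).mem_tangentVectors_iff hp hpN
    (eventually_mem_hatSet_slice hφ hF hp hpN.2.2)

omit [IsManifold (𝓡 n) ∞ M] in
/-- The vectors tangent to an embedded submanifold form a subspace of its dimension. -/
theorem IsEmbeddedSubmanifold.exists_tangentSpace {k : ℕ} (hN : IsEmbeddedSubmanifold n k N)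
    {x : M} (hx : x ∈ N) : ∃ W : Submodule ℝ (TangentSpace (𝓡 n) x), finrank ℝ W = k ∧
      (W : Set (TangentSpace (𝓡 n) x)) = tangentVectors (𝓡 n) N x := by
  obtain ⟨φ, hφ, hxφ, F, hFk, hF⟩ := hN x hx
  have hφ := isSmoothCoord_of_mem_maximalAtlas hφ
  let D := hφ.mdifferentiable.mfderiv hxφ
  refine ⟨Submodule.map D.symm.toLinearEquiv.toLinearMap F, ?_, ?_⟩
  · rw [← hFk]
    exact LinearEquiv.finrank_map_eq D.symm.toLinearEquiv F
  · ext v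
    exact (Submodule.mem_map_equiv (e := D.symm.toLinearEquiv) F).trans
      (mem_tangentVectors_slice hφ hF hxφ hx v).symm

/-- The vectors tangent to `N̂` form a subspace. -/
theorem IsEmbeddedSubmanifold.exists_tangentSpace_hatSet {k : ℕ}
    (hN : IsEmbeddedSubmanifold n k N) {p : TangentBundle (𝓡 n) M} (hp : p ∈ hatSet N) :
    ∃ T : Submodule ℝ (TangentSpace (𝓡 n).tangent p),
      (T : Set (TangentSpace (𝓡 n).tangent p)) = tangentVectors (𝓡 n).tangent (hatSet N) p := by
  obtain ⟨φ, hφ, hxφ, F, hFk, hF⟩ := hN p.1 hp.1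
  have hφ := isSmoothCoord_of_mem_maximalAtlas hφ
  refine ⟨Submodule.comap (mfderiv (𝓡 n).tangent
    𝓘(ℝ, EuclideanSpace ℝ (Fin n) × EuclideanSpace ℝ (Fin n))
        (tangentCoord hφ) p).toLinearMap (F.prod F), ?_⟩
  ext v
  exact (mem_tangentVectors_hatSet hφ hF hxφ hp v).symm

/-- The vertical vectors tangent to `N̂` are the vertical lifts of the vectors tangent to `N`. -/
theorem IsEmbeddedSubmanifold.verticalLift_mem_iff {k : ℕ}
    (hN : IsEmbeddedSubmanifold n k N) {p : TangentBundle (𝓡 n) M} (hp : p ∈ hatSet N)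
    (w : TangentSpace (𝓡 n) p.1) :
    verticalLift p w ∈ tangentVectors (𝓡 n).tangent (hatSet N) p ↔
      w ∈ tangentVectors (𝓡 n) N p.1 := by
  obtain ⟨φ, hφ, hxφ, F, hFk, hF⟩ := hN p.1 hp.1
  have hφ := isSmoothCoord_of_mem_maximalAtlas hφ
  rw [mem_tangentVectors_hatSet hφ hF hxφ hp]
  refine Iff.trans ?_ (mem_tangentVectors_slice hφ hF hxφ hp.1 w).symm
  have h := mfderiv_tangentCoord_vertical hφ hxφ w
  constructor
  · intro h1
    exact ((congrArg (· ∈ F.prod F) h).mp h1).2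
  · intro h1
    exact (congrArg (· ∈ F.prod F) h).mpr ⟨F.zero_mem, h1⟩

theorem baseVector_mem_of_mem_tangentVectors_hatSet {p : TangentBundle (𝓡 n) M}
    {X : TangentSpace (𝓡 n).tangent p}
    (hX : X ∈ tangentVectors (𝓡 n).tangent (hatSet N) p) :
    baseVector p X ∈ tangentVectors (𝓡 n) N p.1 := by
  have h := hasMFDerivAt_tangentBundle_proj p
  refine tangentMap_mem_tangentVectors h.mdifferentiableAt (Eventually.of_forall fun z hz ↦ hz.1)
    hX ?_
  rw [tangentMap, h.mfderiv]
  rfl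

/-- The projection of `N̂` to `N` is a submersion. -/
theorem IsEmbeddedSubmanifold.exists_lift {k : ℕ}
    (hN : IsEmbeddedSubmanifold n k N) {p : TangentBundle (𝓡 n) M} (hp : p ∈ hatSet N)
    {w : TangentSpace (𝓡 n) p.1} (hw : w ∈ tangentVectors (𝓡 n) N p.1) :
    ∃ X ∈ tangentVectors (𝓡 n).tangent (hatSet N) p, baseVector p X = w := by
  obtain ⟨φ, hφ, hxφ, F, hFk, hF⟩ := hN p.1 hp.1
  have hφ := isSmoothCoord_of_mem_maximalAtlas hφ
  have hwF := (mem_tangentVectors_slice hφ hF hxφ hp.1 w).1 hw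
  have hpc : p ∈ (tangentCoord hφ).source := hxφ
  obtain ⟨X, hX⟩ := (isSmoothCoord_tangentCoord hφ).mdifferentiable.mfderiv_surjective hpc
    (((mfderiv (𝓡 n) (𝓡 n) φ p.1 w : EuclideanSpace ℝ (Fin n)), 0) :
      EuclideanSpace ℝ (Fin n) × EuclideanSpace ℝ (Fin n))
  refine ⟨X, (mem_tangentVectors_hatSet hφ hF hxφ hp X).2 ?_, ?_⟩
  · exact (congrArg (· ∈ F.prod F) hX).mpr ⟨hwF, F.zero_mem⟩
  · have h := mfderiv_tangentCoord_fst hφ hxφ (comps X).1 (comps X).2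
    exact hφ.mdifferentiable.mfderiv_injective hxφ (h.symm.trans (congrArg Prod.fst hX))

/-- For closed `N`, the set `N̂` is closed in the slit tangent bundle. -/
theorem eventually_notMem_hatSet {k : ℕ} (hNc : IsClosed N) (hN : IsEmbeddedSubmanifold n k N)
    {p : TangentBundle (𝓡 n) M} (hps : p ∈ slit n M) (hp : p ∉ hatSet N) :
    ∀ᶠ q in 𝓝 p, q ∉ hatSet N := by
  by_cases hpN : p.1 ∈ N
  · obtain ⟨φ, hφ, hxφ, F, hFk, hF⟩ := hN p.1 hpN
    have hφ := isSmoothCoord_of_mem_maximalAtlas hφ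
    have hpc : p ∈ (tangentCoord hφ).source := hxφ
    have hcl := (F.prod F).closed_of_finiteDimensional
    have hp' := (not_congr (mem_hatSet_slice hφ hF hxφ hps)).1 hp
    filter_upwards [eventually_mem_hatSet_slice hφ hF hxφ hps,
      ((tangentCoord hφ).continuousAt hpc).eventually (hcl.isOpen_compl.mem_nhds hp')]
      with q h1 h2 h3 using h2 (h1.1 h3)
  · have hc := (hasMFDerivAt_tangentBundle_proj p).continuousAt
    filter_upwards [hc.eventually (hNc.isOpen_compl.mem_nhds hpN)] with q h1 h2 using h1 h2.1

end Surfaces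

/-! ### Saturation under the projection to the path space -/

section PathSpace

variable {n : ℕ} {M : Type*} [TopologicalSpace M] [ChartedSpace (EuclideanSpace ℝ (Fin n)) M]
  [IsManifold (𝓡 n) ∞ M]
  {P : Type*} [TopologicalSpace P]
  [ChartedSpace (EuclideanSpace ℝ (Fin (2 * n - 2))) P] [IsManifold (𝓡 (2 * n - 2)) ∞ P]
  {Γ : ∀ p : TangentBundle (𝓡 n) M, TangentSpace (𝓡 n).tangent p}
  {π : TangentBundle (𝓡 n) M → P} {N : Set M}

theorem IsPathSpace.contMDiffAt (hπ : IsPathSpace Γ π) {p : TangentBundle (𝓡 n) M}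
    (hp : p ∈ slit n M) : ContMDiffAt (𝓡 n).tangent (𝓡 (2 * n - 2)) ∞ π p :=
  hπ.smooth.contMDiffAt (isOpen_slit.mem_nhds hp)

/-- The distribution `D` is tangent to `N̂` for every totally-geodesic surface `N`. -/
theorem IsTotallyGeodesicSurface.ker_mem (hN : IsTotallyGeodesicSurface Γ N)
    (hπ : IsPathSpace Γ π) {p : TangentBundle (𝓡 n) M} (hp : p ∈ hatSet N)
    {X : TangentSpace (𝓡 n).tangent p}
    (hX : mfderiv (𝓡 n).tangent (𝓡 (2 * n - 2)) π p X = 0) :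
    X ∈ tangentVectors (𝓡 n).tangent (hatSet N) p := by
  obtain ⟨T, hT⟩ := hN.embedded.exists_tangentSpace_hatSet hp
  rw [hπ.ker p hp.2.2] at hX
  rw [← hT]
  refine Submodule.span_le.2 ?_ hX
  rintro Y (rfl | rfl)
  · rw [hT]; exact hN.tangent p hp
  · rw [hT]; exact (hN.embedded.verticalLift_mem_iff hp p.2).2 hp.2.1

/-- For a totally-geodesic surface `N` the set `N̂` is a union of leaves of `D`: it is relatively
closed in each leaf because `N` is closed, and relatively open because `D` is tangent to it. -/
theorem IsTotallyGeodesicSurface.mem_hatSet_of_eq (hN : IsTotallyGeodesicSurface Γ N)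
    (hπ : IsPathSpace Γ π) {p q : TangentBundle (𝓡 n) M} (hp : p ∈ hatSet N) (hq : q ∈ slit n M)
    (hpq : π q = π p) : q ∈ hatSet N := by
  have hopen : ∀ z ∈ hatSet N, ∀ᶠ y in 𝓝 z, π y = π z → y ∈ hatSet N := by
    intro z hz
    obtain ⟨φ, hφ, hxφ, F, -, hF⟩ := hN.embedded z.1 hz.1
    have hφ := isSmoothCoord_of_mem_maximalAtlas hφ
    refine (isSmoothCoord_tangentCoord hφ).eventually_fiber_subset (isSmoothCoord_chartAt (π z))
      hxφ (mem_chart_source _ _) ?_ (hπ.submersion z hz.2.2) hz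
      (eventually_mem_hatSet_slice hφ hF hxφ hz.2.2)
      (Eventually.of_forall fun y hy v hv ↦ hN.ker_mem hπ hy hv)
    filter_upwards [isOpen_slit.mem_nhds hz.2.2] with y hy using hπ.contMDiffAt hy
  have hpre := (hπ.connected (π p)).isPreconnected
  let U : Set (TangentBundle (𝓡 n) M) := {z | ∀ᶠ y in 𝓝 z, π y = π p → y ∈ hatSet N}
  let V : Set (TangentBundle (𝓡 n) M) := {z | ∀ᶠ y in 𝓝 z, y ∉ hatSet N}
  by_contra hqN
  obtain ⟨z, ⟨-, hzp⟩, hzU, hzV⟩ := hpre U V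
    (isOpen_iff_mem_nhds.2 fun z hz ↦ hz.eventually_nhds)
    (isOpen_iff_mem_nhds.2 fun z hz ↦ hz.eventually_nhds)
    (fun z hz ↦ by
      by_cases hzN : z ∈ hatSet N
      · exact Or.inl (by have := hopen z hzN; rwa [hz.2] at this)
      · exact Or.inr (eventually_notMem_hatSet hN.isClosed hN.embedded hz.1 hzN))
    ⟨p, ⟨hp.2.2, rfl⟩, hopen p hp⟩
    ⟨q, ⟨hq, hpq⟩, eventually_notMem_hatSet hN.isClosed hN.embedded hq hqN⟩
  exact hzV.self_of_nhds (hzU.self_of_nhds hzp)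

/-- The image of `N̂` has as tangent vectors exactly the images of the tangent vectors of `N̂`. -/
theorem IsTotallyGeodesicSurface.tangentVectors_image (hN : IsTotallyGeodesicSurface Γ N)
    (hπ : IsPathSpace Γ π) {p : TangentBundle (𝓡 n) M} (hp : p ∈ hatSet N) :
    tangentVectors (𝓡 (2 * n - 2)) (π '' hatSet N) (π p) =
      mfderiv (𝓡 n).tangent (𝓡 (2 * n - 2)) π p ''
        tangentVectors (𝓡 n).tangent (hatSet N) p := by
  have hd := (hπ.contMDiffAt hp.2.2).mdifferentiableAt (n := ∞) (by simp)
  ext ξ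
  constructor
  · intro hξ
    have hφ := isSmoothCoord_chartAt (n := n) p.1
    obtain ⟨s, hsd, hsp, hs⟩ := (isSmoothCoord_tangentCoord hφ).exists_local_section
      (isSmoothCoord_chartAt (π p)) (mem_chart_source _ p.1) (mem_chart_source _ _)
      (hπ.contMDiffAt hp.2.2) (hπ.submersion p hp.2.2)
    obtain ⟨X, hX⟩ : ∃ X : TangentSpace (𝓡 n).tangent p,
        tangentMap (𝓡 (2 * n - 2)) (𝓡 n).tangent s ⟨π p, ξ⟩ = ⟨p, X⟩ :=
      ⟨mfderiv (𝓡 (2 * n - 2)) (𝓡 n).tangent s (π p) ξ,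
        congrArg (fun z ↦ (⟨z, mfderiv (𝓡 (2 * n - 2)) (𝓡 n).tangent s (π p) ξ⟩ :
          TangentBundle (𝓡 n).tangent (TangentBundle (𝓡 n) M))) hsp⟩
    refine ⟨X, tangentMap_mem_tangentVectors hsd ?_ hξ hX, ?_⟩
    · have hslit : ∀ᶠ w in 𝓝 (π p), s w ∈ slit n M :=
        hsd.continuousAt.eventually (by rw [hsp]; exact isOpen_slit.mem_nhds hp.2.2)
      filter_upwards [hs, hslit] with w h1 h2
      rintro ⟨y, hy, rfl⟩
      exact hN.mem_hatSet_of_eq hπ hy h2 h1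
    · have hd' : MDifferentiableAt (𝓡 n).tangent (𝓡 (2 * n - 2)) π (s (π p)) := hsp.symm ▸ hd
      have h1 := tangentMap_comp_at (⟨π p, ξ⟩ : TangentBundle (𝓡 (2 * n - 2)) P) hd' hsd
      have h2 : π ∘ s =ᶠ[𝓝 (π p)] id := hs
      rw [tangentMap_eq_self h2, hX] at h1
      exact (eq_of_heq (Bundle.TotalSpace.mk.inj h1).2).symm
  · rintro ⟨X, hX, rfl⟩
    exact tangentMap_mem_tangentVectors hd (Eventually.of_forall fun z hz ↦ mem_image_of_mem π hz)
      hX rfl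

/-- The Kähler lift pairs a tangent vector with a vertical one through `h`. -/
theorem kahlerLift_verticalLift (h : ∀ p : TangentBundle (𝓡 n) M,
      TangentSpace (𝓡 n) p.1 →L[ℝ] TangentSpace (𝓡 n) p.1 →L[ℝ] ℝ)
    (p : TangentBundle (𝓡 n) M) (X : TangentSpace (𝓡 n).tangent p) (w : TangentSpace (𝓡 n) p.1) :
    kahlerLift Γ h p X (verticalLift p w) = h p (baseVector p X) w := by
  have h1 : vertForm Γ p (verticalLift p w) = w := by
    change (comps (verticalLift p w)).2 + connCoeff Γ p 0 = w
    rw [map_zero, add_zero]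
    rfl
  have h2 : h p (comps (verticalLift p w)).1 = 0 := map_zero (h p)
  rw [kahlerLift, h1, h2]
  exact sub_zero _

end PathSpace

/-! ### The induced form on the image of a totally-geodesic surface -/

section Main

variable {n : ℕ} {M : Type*} [TopologicalSpace M] [ChartedSpace (EuclideanSpace ℝ (Fin n)) M]
  [IsManifold (𝓡 n) ∞ M]
  {P : Type*} [TopologicalSpace P]
  [ChartedSpace (EuclideanSpace ℝ (Fin (2 * n - 2))) P] [IsManifold (𝓡 (2 * n - 2)) ∞ P]
  {Γ : ∀ p : TangentBundle (𝓡 n) M, TangentSpace (𝓡 n).tangent p}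
  {π : TangentBundle (𝓡 n) M → P} {N : Set M}
  {h : ∀ p : TangentBundle (𝓡 n) M,
      TangentSpace (𝓡 n) p.1 →L[ℝ] TangentSpace (𝓡 n) p.1 →L[ℝ] ℝ}
  {Ω : ∀ z : P, TangentSpace (𝓡 (2 * n - 2)) z [⋀^Fin 2]→L[ℝ] ℝ}

theorem IsSpray.baseVector_eq (hΓ : IsSpray Γ) {p : TangentBundle (𝓡 n) M} (hp : p ∈ slit n M) :
    baseVector p (Γ p) = p.2 := by
  have h1 := hΓ.secondOrder p hp
  rw [(hasMFDerivAt_tangentBundle_proj p).mfderiv] at h1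
  exact h1

theorem span_pair_eq_of_finrank_eq_two {V : Type*} [AddCommGroup V] [Module ℝ V]
    {W : Submodule ℝ V} (hW : finrank ℝ W = 2) {a b : V} (ha : a ∈ W) (hb : b ∈ W)
    (hab : LinearIndependent ℝ ![a, b]) : Submodule.span ℝ {a, b} = W := by
  have : Module.Finite ℝ W := Module.finite_of_finrank_pos (by omega)
  refine Submodule.eq_of_le_of_finrank_eq (Submodule.span_le.2 ?_) ?_
  · rintro x (rfl | rfl) <;> assumption
  · have h := finrank_span_eq_card hab
    rw [Matrix.range_cons_cons_empty] at h
    rw [h, hW, Fintype.card_fin]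

theorem exists_independent_of_finrank_eq_two {V : Type*} [AddCommGroup V] [Module ℝ V]
    {W : Submodule ℝ V} (hW : finrank ℝ W = 2) {y : V} (hy0 : y ≠ 0) :
    ∃ e ∈ W, LinearIndependent ℝ ![y, e] := by
  by_contra! hcon
  have hle : W ≤ Submodule.span ℝ {y} := fun e he ↦ by
    have h1 := hcon e he
    rw [LinearIndependent.pair_iff' hy0] at h1
    push Not at h1
    exact Submodule.mem_span_singleton.2 h1
  have h1 := Submodule.finrank_mono hle
  have h2 := finrank_span_singleton (K := ℝ) hy0
  omega

/-- An alternating form vanishing on a pair vanishes on its span. -/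
theorem alternating_span_pair {V : Type*} [TopologicalSpace V] [AddCommGroup V] [Module ℝ V]
    (A : V [⋀^Fin 2]→L[ℝ] ℝ) {a b ξ η : V} (hξ : ξ ∈ Submodule.span ℝ {a, b})
    (hη : η ∈ Submodule.span ℝ {a, b}) (h : A ![a, b] = 0) : A ![ξ, η] = 0 := by
  have hupd : ∀ x y z : V, Function.update ![x, z] 0 y = ![y, z] := fun x y z ↦ by
    ext i; fin_cases i <;> simp
  have hadd : ∀ x y z : V, A ![x + y, z] = A ![x, z] + A ![y, z] := fun x y z ↦ by
    have := A.map_update_add ![x, z] 0 x y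
    rwa [hupd, hupd, hupd] at this
  have hsmul : ∀ (c : ℝ) (x z : V), A ![c • x, z] = c * A ![x, z] := fun c x z ↦ by
    have := A.map_update_smul ![x, z] 0 c x
    rwa [hupd, hupd] at this
  have hself : ∀ x : V, A ![x, x] = 0 := fun x ↦
    A.map_eq_zero_of_eq ![x, x] (i := 0) (j := 1) rfl (by simp)
  have hswap : ∀ x z : V, A ![x, z] = -A ![z, x] := fun x z ↦ by
    have h1 := A.toAlternatingMap.map_swap ![z, x] (i := 0) (j := 1) (by simp)
    have h2 : (![z, x] ∘ Equiv.swap (0 : Fin 2) 1) = ![x, z] := by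
      ext i; fin_cases i <;> simp
    rw [h2] at h1
    exact h1
  obtain ⟨s, t, rfl⟩ := Submodule.mem_span_pair.1 hξ
  obtain ⟨s', t', rfl⟩ := Submodule.mem_span_pair.1 hη
  have hba : A ![b, a] = 0 := by rw [hswap, h, neg_zero]
  have h1 : ∀ x ∈ ({a, b} : Set V), A ![x, s' • a + t' • b] = 0 := by
    rintro x (rfl | rfl) <;> rw [hswap, hadd, hsmul, hsmul] <;> simp [hself, h, hba]
  rw [hadd, hsmul, hsmul, h1 a (by simp), h1 b (by simp), mul_zero, mul_zero, add_zero]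

/-- The images in the path space of a vector over `e` and of the vertical vector along `e` are
independent, since a combination of `Γ` and `Δ` without component along `e` vanishes. -/
theorem linearIndependent_mfderiv_of_lift (hΓ : IsSpray Γ) (hπ : IsPathSpace Γ π)
    {p : TangentBundle (𝓡 n) M} (hp : p ∈ slit n M) {e : TangentSpace (𝓡 n) p.1}
    (he : LinearIndependent ℝ ![p.2, e]) {X : TangentSpace (𝓡 n).tangent p}
    (hX : baseVector p X = e) :
    LinearIndependent ℝ ![mfderiv (𝓡 n).tangent (𝓡 (2 * n - 2)) π p X,
      mfderiv (𝓡 n).tangent (𝓡 (2 * n - 2)) π p (verticalLift p e)] := by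
  rw [LinearIndependent.pair_iff] at he ⊢
  intro a b hab
  rw [← map_smul, ← map_smul, ← map_add, hπ.ker p hp, Submodule.mem_span_pair] at hab
  obtain ⟨c, d, hcd⟩ := hab
  have h1 := congrArg (baseVector p) hcd
  have hΔ : baseVector p (liouville n M p) = 0 := rfl
  rw [map_add, map_add, map_smul, map_smul, map_smul, map_smul, hΔ, hΓ.baseVector_eq hp, hX,
    baseVector_verticalLift, smul_zero, smul_zero, add_zero, add_zero] at h1
  obtain ⟨hc, ha⟩ := he c (-a) (by rw [neg_smul]; exact add_neg_eq_zero.2 h1)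
  have ha : a = 0 := neg_eq_zero.1 ha
  subst hc ha
  rw [zero_smul, zero_smul, zero_add, zero_add, ← map_smul] at hcd
  have h2 : d • p.2 = b • e :=
    verticalLift_injective p ((map_smul (verticalLift p) d p.2).trans hcd)
  obtain ⟨hd, hb⟩ := he d (-b) (by rw [neg_smul]; exact add_neg_eq_zero.2 h2)
  exact ⟨rfl, neg_eq_zero.1 hb⟩

/-- If `Ω` induces a volume form on the surface `N̄`, then `h` is nonzero on vectors of `T N`
independent of the velocity. -/
theorem apply_self_ne_zero_of_isVolumeFormOn (hΓ : IsSpray Γ) (hπ : IsPathSpace Γ π)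
    (hω : ∀ p ∈ slit n M, ∀ X Y : TangentSpace (𝓡 n).tangent p,
      Ω (π p) ![mfderiv (𝓡 n).tangent (𝓡 (2 * n - 2)) π p X,
        mfderiv (𝓡 n).tangent (𝓡 (2 * n - 2)) π p Y] = kahlerLift Γ h p X Y)
    (hN : IsTotallyGeodesicSurface Γ N) (hV : IsVolumeFormOn Ω (π '' hatSet N))
    {p : TangentBundle (𝓡 n) M} (hp : p ∈ hatSet N)
    {e : TangentSpace (𝓡 n) p.1} (heN : e ∈ tangentVectors (𝓡 n) N p.1)
    (he : LinearIndependent ℝ ![p.2, e]) : h p e e ≠ 0 := by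
  obtain ⟨X, hXN, hX⟩ := hN.embedded.exists_lift hp heN
  obtain ⟨W, hW2, hW, ξ, hξ, η, hη, hne⟩ := hV (π p) (mem_image_of_mem π hp)
  have hmem : ∀ Y ∈ tangentVectors (𝓡 n).tangent (hatSet N) p,
      mfderiv (𝓡 n).tangent (𝓡 (2 * n - 2)) π p Y ∈ W := fun Y hY ↦ by
    rw [← SetLike.mem_coe, hW, hN.tangentVectors_image hπ hp]
    exact mem_image_of_mem _ hY
  have hspan := span_pair_eq_of_finrank_eq_two hW2 (hmem _ hXN)
    (hmem _ ((hN.embedded.verticalLift_mem_iff hp e).2 heN))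
    (linearIndependent_mfderiv_of_lift hΓ hπ hp.2.2 he hX)
  rw [← hspan] at hξ hη
  intro h0
  refine hne (alternating_span_pair (Ω (π p)) hξ hη ?_)
  rw [hω p hp.2.2, kahlerLift_verticalLift, hX, h0]

/-- The plane tangent to `N̄` at `π p` is spanned by the images of a vector over some `e` independent
of the velocity and of the vertical lift of `e`; on this pair `Ω` equals `h p e e`. -/
theorem isVolumeFormOn_of_isPosQuasiDef (hΓ : IsSpray Γ) (hπ : IsPathSpace Γ π)
    (hω : ∀ p ∈ slit n M, ∀ X Y : TangentSpace (𝓡 n).tangent p,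
      Ω (π p) ![mfderiv (𝓡 n).tangent (𝓡 (2 * n - 2)) π p X,
        mfderiv (𝓡 n).tangent (𝓡 (2 * n - 2)) π p Y] = kahlerLift Γ h p X Y)
    (hN : IsTotallyGeodesicSurface Γ N) (hh : IsPosQuasiDef h) :
    IsVolumeFormOn Ω (π '' hatSet N) := by
  rintro _ ⟨p, hp, rfl⟩
  obtain ⟨Wx, hWx2, hWx⟩ := hN.embedded.exists_tangentSpace hp.1
  have hyW : p.2 ∈ Wx := by rw [← SetLike.mem_coe, hWx]; exact hp.2.1
  obtain ⟨e, heW, he⟩ := exists_independent_of_finrank_eq_two hWx2 (y := p.2) hp.2.2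
  have heN : e ∈ tangentVectors (𝓡 n) N p.1 := by rw [← hWx]; exact heW
  obtain ⟨X, hXN, hX⟩ := hN.embedded.exists_lift hp heN
  have hvN := (hN.embedded.verticalLift_mem_iff hp e).2 heN
  have hli := linearIndependent_mfderiv_of_lift hΓ hπ hp.2.2 he hX
  obtain ⟨T, hT⟩ := hN.embedded.exists_tangentSpace_hatSet hp
  have hspan := span_pair_eq_of_finrank_eq_two hWx2 hyW heW he
  have h2 := finrank_span_eq_card hli
  rw [Matrix.range_cons_cons_empty, Fintype.card_fin] at h2
  refine ⟨_, h2, ?_, _, Submodule.subset_span (mem_insert _ _), _,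
    Submodule.subset_span (mem_insert_of_mem _ (mem_singleton _)), ?_⟩
  · rw [hN.tangentVectors_image hπ hp, ← hT]
    apply Subset.antisymm
    · have : Submodule.span ℝ {mfderiv (𝓡 n).tangent (𝓡 (2 * n - 2)) π p X,
          mfderiv (𝓡 n).tangent (𝓡 (2 * n - 2)) π p (verticalLift p e)} ≤
          T.map (mfderiv (𝓡 n).tangent (𝓡 (2 * n - 2)) π p).toLinearMap := by
        refine Submodule.span_le.2 ?_
        rintro x (rfl | rfl)
        · exact ⟨X, by rw [hT]; exact hXN, rfl⟩
        · exact ⟨verticalLift p e, by rw [hT]; exact hvN, rfl⟩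
      exact this
    · rintro _ ⟨Y, hY, rfl⟩
      -- Modulo `Γ` and `X`, the vector `Y` is vertical; modulo `Δ`, it is then a multiple of
      -- the vertical vector along `e`.
      have hY1 : baseVector p Y ∈ Wx := by
        rw [← SetLike.mem_coe, hWx]
        rw [hT] at hY
        exact baseVector_mem_of_mem_tangentVectors_hatSet hY
      rw [← hspan, Submodule.mem_span_pair] at hY1
      obtain ⟨β, α, hαβ⟩ := hY1
      have hΓT : Γ p ∈ T := by rw [← SetLike.mem_coe, hT]; exact hN.tangent p hp
      have hXT : X ∈ T := by rw [← SetLike.mem_coe, hT]; exact hXN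
      have hZ : Y - α • X - β • Γ p ∈ T :=
        T.sub_mem (T.sub_mem hY (T.smul_mem _ hXT)) (T.smul_mem _ hΓT)
      obtain ⟨w, hw⟩ : ∃ w, verticalLift p w = Y - α • X - β • Γ p := by
        refine exists_verticalLift_eq ?_
        rw [map_sub, map_sub, map_smul, map_smul, hX, hΓ.baseVector_eq hp.2.2, ← hαβ]
        module
      rw [← hw, ← SetLike.mem_coe, hT, hN.embedded.verticalLift_mem_iff hp, ← hWx,
        SetLike.mem_coe, ← hspan, Submodule.mem_span_pair] at hZ
      obtain ⟨δ, γ, rfl⟩ := hZ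
      have hY' : Y = α • X + β • Γ p + (δ • liouville n M p + γ • verticalLift p e) := by
        have h3 : δ • liouville n M p + γ • verticalLift p e = Y - α • X - β • Γ p := by
          rw [← hw, map_add, map_smul, map_smul]; rfl
        rw [h3]; abel
      have hΓ0 := (hπ.ker p hp.2.2 (Γ p)).2 (Submodule.subset_span (mem_insert _ _))
      have hΔ0 := (hπ.ker p hp.2.2 (liouville n M p)).2
        (Submodule.subset_span (mem_insert_of_mem _ (mem_singleton _)))
      refine Submodule.mem_span_pair.2 ⟨α, γ, ?_⟩
      rw [hY', map_add, map_add, map_add, map_smul, map_smul, map_smul, map_smul, hΓ0, hΔ0,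
        smul_zero, smul_zero, add_zero, zero_add]
  · rw [hω p hp.2.2, kahlerLift_verticalLift, hX]
    intro h0
    obtain ⟨c, hc⟩ := (hh p hp.2.2 e).2 h0
    exact (LinearIndependent.pair_iff' hp.2.2).1 he c hc.symm

/-- The velocity is a null vector of `h`, because `Γ` is in the kernel of the Kähler lift. -/
theorem apply_velocity_eq_zero (hΓ : IsSpray Γ) (hπ : IsPathSpace Γ π)
    (hω : ∀ p ∈ slit n M, ∀ X Y : TangentSpace (𝓡 n).tangent p,
      Ω (π p) ![mfderiv (𝓡 n).tangent (𝓡 (2 * n - 2)) π p X,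
        mfderiv (𝓡 n).tangent (𝓡 (2 * n - 2)) π p Y] = kahlerLift Γ h p X Y)
    {p : TangentBundle (𝓡 n) M} (hp : p ∈ slit n M) : h p p.2 p.2 = 0 := by
  have h1 := hω p hp (Γ p) (verticalLift p p.2)
  have h2 : mfderiv (𝓡 n).tangent (𝓡 (2 * n - 2)) π p (Γ p) = 0 :=
    (hπ.ker p hp (Γ p)).2 (Submodule.subset_span (mem_insert _ _))
  rw [h2, kahlerLift_verticalLift, hΓ.baseVector_eq hp] at h1
  rw [← h1]
  exact (Ω (π p)).map_coord_zero 0 rfl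

end Main

/-! ### Constancy of the sign -/

section Sign

/-- A nonvanishing continuous function on a preconnected set has constant sign. -/
theorem IsPreconnected.pos_of_pos {X : Type*} [TopologicalSpace X] {s : Set X}
    (hs : IsPreconnected s) {f : X → ℝ} (hf : ContinuousOn f s) (hne : ∀ x ∈ s, f x ≠ 0) {a b : X}
    (ha : a ∈ s) (hb : b ∈ s) (h : 0 < f a) : 0 < f b := by
  by_contra hcon
  obtain ⟨c, hc, hc0⟩ := hs.intermediate_value hb ha hf ⟨not_lt.1 hcon, h.le⟩
  exact hne c hc hc0

variable {E : Type*} [NormedAddCommGroup E] [NormedSpace ℝ E] [FiniteDimensional ℝ E]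

omit [FiniteDimensional ℝ E] in
theorem continuous_bilinear_comp_self (B : E →L[ℝ] E →L[ℝ] ℝ) (L : E →L[ℝ] E) :
    Continuous fun a ↦ B (L a) (L a) := by
  fun_prop

/-- In dimension at least three the complement of a line is connected. -/
theorem isPreconnected_compl_span_singleton (hE : 3 ≤ finrank ℝ E) (w : E) :
    IsPreconnected ((Submodule.span ℝ {w} : Submodule ℝ E) : Set E)ᶜ := by
  refine (isConnected_compl_of_one_lt_codim ?_).isPreconnected
  have h1 := (Submodule.span ℝ {w}).finrank_quotient_add_finrank
  have h2 := finrank_span_le_card (R := ℝ) ({w} : Set E)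
  rw [toFinset_singleton, Finset.card_singleton] at h2
  rw [← finrank_eq_rank]
  exact_mod_cast (by omega : 1 < finrank ℝ (E ⧸ Submodule.span ℝ {w}))

omit [FiniteDimensional ℝ E] in
theorem linearIndependent_pair_iff_notMem_span {w a : E} (hw : w ≠ 0) :
    LinearIndependent ℝ ![w, a] ↔ a ∉ Submodule.span ℝ {w} := by
  rw [LinearIndependent.pair_iff' hw, Submodule.mem_span_singleton, not_exists]

/-- A function of a parameter and of a pair of independent vectors which is separately continuous
and never zero has constant sign: in dimension at least three any two independent pairs are joined
by changing one vector at a time. -/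
theorem pos_of_pos_of_linearIndependent (hE : 3 ≤ finrank ℝ E) {Y : Type*} [TopologicalSpace Y]
    {U : Set Y} (hU : IsPreconnected U) {g : Y → E → E → ℝ}
    (h1 : ∀ w ≠ 0, ∀ a, ContinuousOn (fun u ↦ g u w a) U)
    (h2 : ∀ u ∈ U, ∀ a, ContinuousOn (fun w ↦ g u w a) {0}ᶜ)
    (h3 : ∀ u ∈ U, ∀ w ≠ 0, Continuous (g u w))
    (hne : ∀ u ∈ U, ∀ w a, LinearIndependent ℝ ![w, a] → g u w a ≠ 0)
    {u u' : Y} (hu : u ∈ U) (hu' : u' ∈ U) {w a w' a' : E} (hwa : LinearIndependent ℝ ![w, a])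
    (hwa' : LinearIndependent ℝ ![w', a']) (hpos : 0 < g u w a) : 0 < g u' w' a' := by
  have hw : w ≠ 0 := hwa.ne_zero 0
  have hw' : w' ≠ 0 := hwa'.ne_zero 0
  obtain ⟨c, hc⟩ : ∃ c, c ∉ Submodule.span ℝ {w, w'} := by
    by_contra! hcon
    have htop : Submodule.span ℝ {w, w'} = ⊤ := Submodule.eq_top_iff'.2 hcon
    have h4 := finrank_range_le_card (R := ℝ) ![w, w']
    rw [Matrix.range_cons_cons_empty, Set.finrank, htop, finrank_top, Fintype.card_fin] at h4
    omega
  have hcw : LinearIndependent ℝ ![w, c] := (linearIndependent_pair_iff_notMem_span hw).2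
    fun h ↦ hc (Submodule.span_mono (by simp) h)
  have hcw' : LinearIndependent ℝ ![w', c] := (linearIndependent_pair_iff_notMem_span hw').2
    fun h ↦ hc (Submodule.span_mono (by simp) h)
  have hc0 : c ≠ 0 := hcw.ne_zero 1
  have step1 : ∀ v ≠ 0, ∀ b b', LinearIndependent ℝ ![v, b] → LinearIndependent ℝ ![v, b'] →
      0 < g u v b → 0 < g u v b' := fun v hv b b' hb hb' ↦
    (isPreconnected_compl_span_singleton hE v).pos_of_pos (h3 u hu v hv).continuousOn
      (fun x hx ↦ hne u hu v x ((linearIndependent_pair_iff_notMem_span hv).2 hx))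
      ((linearIndependent_pair_iff_notMem_span hv).1 hb)
      ((linearIndependent_pair_iff_notMem_span hv).1 hb')
  have step2 : 0 < g u w c → 0 < g u w' c :=
    (isPreconnected_compl_span_singleton hE c).pos_of_pos
      ((h2 u hu c).mono fun x hx hx0 ↦ hx (by rw [mem_singleton_iff.1 hx0]; exact zero_mem _))
      (fun x hx ↦ hne u hu x c (LinearIndependent.pair_symm_iff.1
        ((linearIndependent_pair_iff_notMem_span hc0).2 hx)))
      ((linearIndependent_pair_iff_notMem_span hc0).1 (LinearIndependent.pair_symm_iff.1 hcw))
      ((linearIndependent_pair_iff_notMem_span hc0).1 (LinearIndependent.pair_symm_iff.1 hcw'))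
  exact hU.pos_of_pos (h1 w' hw' a') (fun x hx ↦ hne x hx w' a' hwa') hu hu'
    (step1 w' hw' c a' hcw' hwa' (step2 (step1 w hw a c hwa hcw hpos)))

variable {n : ℕ} {M : Type*} [TopologicalSpace M] [ChartedSpace (EuclideanSpace ℝ (Fin n)) M]
  [IsManifold (𝓡 n) ∞ M]
  {h : ∀ p : TangentBundle (𝓡 n) M,
      TangentSpace (𝓡 n) p.1 →L[ℝ] TangentSpace (𝓡 n) p.1 →L[ℝ] ℝ}

/-- If `h` has no null vectors independent of the velocity, its sign on them is locally constant. -/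
theorem IsSymmMultiplier.eventually_pos_of_pos (hn : 3 ≤ n) (hh : IsSymmMultiplier h)
    (hne : ∀ (x : M) (y e : TangentSpace (𝓡 n) x), LinearIndependent ℝ ![y, e] →
      h (⟨x, y⟩ : TangentBundle (𝓡 n) M) e e ≠ 0) (x₀ : M) :
    ∃ U ∈ 𝓝 x₀, ∀ x ∈ U, ∀ x' ∈ U, ∀ (y e : TangentSpace (𝓡 n) x) (y' e' : TangentSpace (𝓡 n) x'),
      LinearIndependent ℝ ![y, e] → LinearIndependent ℝ ![y', e'] →
      0 < h (⟨x, y⟩ : TangentBundle (𝓡 n) M) e e →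
      0 < h (⟨x', y'⟩ : TangentBundle (𝓡 n) M) e' e' := by
  have hφ := isSmoothCoord_chartAt (n := n) x₀
  let ψ := (extChartAt (𝓡 n) x₀).symm
  let dψ (u : EuclideanSpace ℝ (Fin n)) : EuclideanSpace ℝ (Fin n) →L[ℝ] TangentSpace (𝓡 n) (ψ u) :=
    mfderiv 𝓘(ℝ, EuclideanSpace ℝ (Fin n)) (𝓡 n) ψ u
  have hopen := isOpen_extChartAt_target (I := 𝓡 n) x₀
  obtain ⟨ε, hε, hball⟩ := Metric.isOpen_iff.1 hopen _ (mem_extChartAt_target x₀)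
  have hbij : ∀ u ∈ (extChartAt (𝓡 n) x₀).target, Function.Bijective (dψ u) := fun u hu ↦
    hφ.mdifferentiable.symm.mfderiv_bijective (by simpa using hu)
  have hsm : ∀ a, ContinuousOn (fun q : EuclideanSpace ℝ (Fin n) × EuclideanSpace ℝ (Fin n) ↦
      h (⟨ψ q.1, dψ q.1 q.2⟩ : TangentBundle (𝓡 n) M) (dψ q.1 a) (dψ q.1 a))
      ((extChartAt (𝓡 n) x₀).target ×ˢ {0}ᶜ) := fun a ↦ (hh.smooth x₀ a a).continuousOn
  have hli : ∀ u ∈ (extChartAt (𝓡 n) x₀).target, ∀ w a,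
      LinearIndependent ℝ ![w, a] ↔ LinearIndependent ℝ ![dψ u w, dψ u a] := by
    intro u hu w a
    rw [LinearIndependent.pair_iff, LinearIndependent.pair_iff]
    refine forall₂_congr fun s t ↦ ?_
    rw [← map_smul, ← map_smul, ← map_add, map_eq_zero_iff _ (hbij u hu).1]
  have key := fun {u u'} hu hu' {w a w' a'} ↦ pos_of_pos_of_linearIndependent (u := u) (u' := u')
    (w := w) (a := a) (w' := w') (a' := a')
    (by simpa using hn) (convex_ball (extChartAt (𝓡 n) x₀ x₀) ε).isPreconnected
    (g := fun u w a ↦ h (⟨ψ u, dψ u w⟩ : TangentBundle (𝓡 n) M) (dψ u a) (dψ u a))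
    (fun w hw a ↦ (hsm a).comp (f := fun u ↦ (u, w)) (by fun_prop) fun u hu ↦ ⟨hball hu, hw⟩)
    (fun u hu a ↦ (hsm a).comp (f := fun w ↦ (u, w)) (by fun_prop) fun w hw ↦ ⟨hball hu, hw⟩)
    (fun u hu w hw ↦ continuous_bilinear_comp_self (h (⟨ψ u, dψ u w⟩ : TangentBundle (𝓡 n) M))
      (dψ u))
    (fun u hu w a hwa ↦ hne (ψ u) _ _ ((hli u (hball hu) w a).1 hwa)) hu hu'
  have hcov : ∀ x ∈ (extChartAt (𝓡 n) x₀).source,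
      extChartAt (𝓡 n) x₀ x ∈ Metric.ball (extChartAt (𝓡 n) x₀ x₀) ε →
      ∃ u ∈ Metric.ball (extChartAt (𝓡 n) x₀ x₀) ε, ψ u = x := fun x hx hxb ↦
    ⟨_, hxb, (extChartAt (𝓡 n) x₀).left_inv hx⟩
  refine ⟨(extChartAt (𝓡 n) x₀).source ∩
    extChartAt (𝓡 n) x₀ ⁻¹' Metric.ball (extChartAt (𝓡 n) x₀ x₀) ε,
    inter_mem (extChartAt_source_mem_nhds x₀) ((continuousAt_extChartAt x₀).preimage_mem_nhds (Metric.ball_mem_nhds _ hε)), ?_⟩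
  rintro x ⟨hx1, hx2⟩ x' ⟨hx1', hx2'⟩ y e y' e' hye hye' hpos
  obtain ⟨u, hu, rfl⟩ := hcov x hx1 hx2
  obtain ⟨u', hu', rfl⟩ := hcov x' hx1' hx2'
  obtain ⟨w, rfl⟩ := (hbij u (hball hu)).2 y
  obtain ⟨a, rfl⟩ := (hbij u (hball hu)).2 e
  obtain ⟨w', rfl⟩ := (hbij u' (hball hu')).2 y'
  obtain ⟨a', rfl⟩ := (hbij u' (hball hu')).2 e'
  exact key hu hu' ((hli u (hball hu) _ _).2 hye) ((hli u' (hball hu') _ _).2 hye') hpos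

/-- If `h` has no null vectors independent of the velocity, its sign on them is constant. -/
theorem IsSymmMultiplier.pos_or_neg [ConnectedSpace M] (hn : 3 ≤ n) (hh : IsSymmMultiplier h)
    (hne : ∀ (x : M) (y e : TangentSpace (𝓡 n) x), LinearIndependent ℝ ![y, e] →
      h (⟨x, y⟩ : TangentBundle (𝓡 n) M) e e ≠ 0) :
    (∀ (x : M) (y e : TangentSpace (𝓡 n) x), LinearIndependent ℝ ![y, e] →
      0 < h (⟨x, y⟩ : TangentBundle (𝓡 n) M) e e) ∨
    (∀ (x : M) (y e : TangentSpace (𝓡 n) x), LinearIndependent ℝ ![y, e] →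
      h (⟨x, y⟩ : TangentBundle (𝓡 n) M) e e < 0) := by
  let A : Set M := {x | ∀ y e : TangentSpace (𝓡 n) x, LinearIndependent ℝ ![y, e] →
    0 < h (⟨x, y⟩ : TangentBundle (𝓡 n) M) e e}
  -- There are independent pairs at every point, so the sign at a point determines the sign nearby.
  have hex : ∀ x : M, ∃ y e : TangentSpace (𝓡 n) x, LinearIndependent ℝ ![y, e] := by
    intro x
    have hr : 2 ≤ finrank ℝ (EuclideanSpace ℝ (Fin n)) := by simp; omega
    obtain ⟨f, hf⟩ := exists_linearIndependent_of_le_finrank hr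
    have hf' : ![f 0, f 1] = f := by
      funext i; fin_cases i <;> rfl
    rw [← hf'] at hf
    exact ⟨f 0, f 1, hf⟩
  have hloc : ∀ x₀ : M, ∃ U ∈ 𝓝 x₀, ∀ x ∈ U, ∀ x' ∈ U, x ∈ A → x' ∈ A := by
    intro x₀
    obtain ⟨U, hU, hUp⟩ := hh.eventually_pos_of_pos hn hne x₀
    refine ⟨U, hU, fun x hx x' hx' hxA y' e' hye' ↦ ?_⟩
    obtain ⟨y, e, hye⟩ := hex x
    exact hUp x hx x' hx' y e y' e' hye hye' (hxA y e hye)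
  have hA : IsClopen A := by
    constructor
    · rw [← isOpen_compl_iff, isOpen_iff_mem_nhds]
      intro x hx
      obtain ⟨U, hU, hUp⟩ := hloc x
      filter_upwards [hU] with x' hx' hA' using hx (hUp x' hx' x (mem_of_mem_nhds hU) hA')
    · rw [isOpen_iff_mem_nhds]
      intro x hx
      obtain ⟨U, hU, hUp⟩ := hloc x
      filter_upwards [hU] with x' hx' using hUp x (mem_of_mem_nhds hU) x' hx' hx
  rcases isClopen_iff.1 hA with hA | hA
  · right
    intro x y e hye
    by_contra hcon
    have hpos := lt_of_le_of_ne (not_lt.1 hcon) (hne x y e hye).symm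
    obtain ⟨U, hU, hUp⟩ := hh.eventually_pos_of_pos hn hne x
    have hxA : x ∈ A := fun y' e' hye' ↦
      hUp x (mem_of_mem_nhds hU) x (mem_of_mem_nhds hU) y e y' e' hye hye' hpos
    rw [hA] at hxA
    exact hxA
  · left
    intro x
    have hxA : x ∈ A := hA ▸ mem_univ x
    exact hxA

end Sign

/-! ### Volume forms and positive quasi-definiteness -/

theorem mainTheorem12 {n : ℕ} (hn : 3 ≤ n)
    {M : Type*} [TopologicalSpace M] [T2Space M] [ParacompactSpace M]
    [ChartedSpace (EuclideanSpace ℝ (Fin n)) M] [IsManifold (𝓡 n) ∞ M]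
    {P : Type*} [TopologicalSpace P] [T2Space P]
    [ChartedSpace (EuclideanSpace ℝ (Fin (2 * n - 2))) P] [IsManifold (𝓡 (2 * n - 2)) ∞ P]
    (Γ : ∀ p : TangentBundle (𝓡 n) M, TangentSpace (𝓡 n).tangent p) (hΓ : IsSpray Γ)
    (π : TangentBundle (𝓡 n) M → P) (hπ : IsPathSpace Γ π)
    (h : ∀ p : TangentBundle (𝓡 n) M,
      TangentSpace (𝓡 n) p.1 →L[ℝ] TangentSpace (𝓡 n) p.1 →L[ℝ] ℝ)
    (hh : IsSymmMultiplier h)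
    (Ω : ∀ z : P, TangentSpace (𝓡 (2 * n - 2)) z [⋀^Fin 2]→L[ℝ] ℝ) (hΩ : IsSymplectic Ω)
    (hω : ∀ p ∈ slit n M, ∀ X Y : TangentSpace (𝓡 n).tangent p,
      Ω (π p) ![mfderiv (𝓡 n).tangent (𝓡 (2 * n - 2)) π p X,
        mfderiv (𝓡 n).tangent (𝓡 (2 * n - 2)) π p Y] = kahlerLift Γ h p X Y)
    (hplanes : ∀ (x : M) (W : Submodule ℝ (TangentSpace (𝓡 n) x)), finrank ℝ W = 2 →
      ∃ N : Set M, IsTotallyGeodesicSurface Γ N ∧ x ∈ N ∧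
        tangentVectors (𝓡 n) N x = (W : Set (TangentSpace (𝓡 n) x))) :
    (IsPosQuasiDef h → ∀ N : Set M, IsTotallyGeodesicSurface Γ N →
      IsVolumeFormOn Ω (π '' hatSet N)) ∧
    (ConnectedSpace M →
      (∀ N : Set M, IsTotallyGeodesicSurface Γ N → IsVolumeFormOn Ω (π '' hatSet N)) →
      IsPosQuasiDef h ∨ IsPosQuasiDef (fun p ↦ -h p)) := by
  refine ⟨fun hpos N hN ↦ isVolumeFormOn_of_isPosQuasiDef hΓ hπ hω hN hpos, fun hM hvol ↦ ?_⟩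
  have hne : ∀ (x : M) (y e : TangentSpace (𝓡 n) x), LinearIndependent ℝ ![y, e] →
      h (⟨x, y⟩ : TangentBundle (𝓡 n) M) e e ≠ 0 := by
    intro x y e hye
    have hW := finrank_span_eq_card hye
    rw [Matrix.range_cons_cons_empty, Fintype.card_fin] at hW
    obtain ⟨N, hN, hxN, hTN⟩ := hplanes x _ hW
    have hyN : y ∈ tangentVectors (𝓡 n) N x := by
      rw [hTN]; exact Submodule.subset_span (mem_insert _ _)
    have heN : e ∈ tangentVectors (𝓡 n) N x := by
      rw [hTN]; exact Submodule.subset_span (mem_insert_of_mem _ (mem_singleton _))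
    exact apply_self_ne_zero_of_isVolumeFormOn hΓ hπ hω hN (hvol N hN)
      (p := ⟨x, y⟩) ⟨hxN, hyN, hye.ne_zero 0⟩ heN hye
  have hdep : ∀ p ∈ slit n M, ∀ v : TangentSpace (𝓡 n) p.1,
      LinearIndependent ℝ ![p.2, v] ∨ h p v v = 0 ∧ ∃ c : ℝ, v = c • p.2 := by
    intro p hp v
    rw [LinearIndependent.pair_iff' hp, or_iff_not_imp_left]
    push Not
    rintro ⟨c, rfl⟩
    refine ⟨?_, c, rfl⟩
    rw [map_smul, map_smul, smul_apply, apply_velocity_eq_zero hΓ hπ hω hp,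
      smul_zero, smul_zero]
  rcases hh.pos_or_neg hn hne with hs | hs
  · left
    intro p hp v
    rcases hdep p hp v with hv | ⟨h0, hc⟩
    · exact ⟨(hs p.1 p.2 v hv).le, fun h0 ↦ absurd h0 (hs p.1 p.2 v hv).ne'⟩
    · exact ⟨h0.ge, fun _ ↦ hc⟩
  · right
    intro p hp v
    change 0 ≤ -(h p v v) ∧ (-(h p v v) = 0 → _)
    rcases hdep p hp v with hv | ⟨h0, hc⟩
    · have h1 : h p v v < 0 := hs p.1 p.2 v hv
      exact ⟨by linarith, fun h0 ↦ by linarith⟩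
    · exact ⟨by rw [h0, neg_zero], fun _ ↦ hc⟩
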